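/- Let $\Gamma$ be a countable discrete group and let $N_0\supseteq N_1\supseteq N_2\supseteq\cdots$ be a nested sequence of finite index normal subgroups of $\Gamma$, with quotient maps $\pi_j\colon\Gamma\to\Gamma/N_j$. Assume that $\{\Gamma/N_j\}_j$ is an FD family, i.e. that the irreducible unitary representations of $\Gamma$ that factor through some $\pi_j$ are dense in the unitary dual of $\Gamma$ with respect to Fell's topology. Let $A_j=C(\Gamma/N_j)$ be the finite-dimensional commutative $C^*$-algebra spanned by its minimal projections $p_{j,g}$, $g\in\Gamma/N_j$, with $\Gamma$ and $\Gamma/N_j$ acting by left translation, and for $i\le j$ let $\rho_{i,j}\colon A_i\to A_j$ be the $\Gamma$-equivariant homomorphism with $\rho_{i,j}(p_{i,g})=\sum_{g'\mapsto g}p_{j,g'}$, the sum being over all $g'\in\Gamma/N_j$ that map to $g$ under the canonical map $\Gamma/N_j\to\Gamma/N_i$. Let $\rho_{i,j}\rtimes\pi_j\colon A_i\rtimes\Gamma\to A_j\rtimes\Gamma/N_j$ be the induced homomorphism of maximal crossed products. Then for every $i$ the $*$-homomorphism $$A_i\rtimes\Gamma\longrightarrow\prod_{j\ge i}A_j\rtimes\Gamma/N_j,\qquad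 x\mapsto\big((\rho_{i,j}\rtimes\pi_j)(x)\big)_{j\ge i},$$ into the $\ell^\infty$-product is isometric. Moreover (equivalently), every representation $\sigma$ of $A_i\rtimes\Gamma$ on a Hilbert space is weakly contained in the set of representations of the form $\tau\circ(\rho_{i,j}\rtimes\pi_j)$, where $j\ge i$ and $\tau$ is a representation of $A_j\rtimes\Gamma/N_j$; that is, every positive functional $x\mapsto\langle\sigma(x)\xi,\xi\rangle$ is a pointwise limit of finite sums of functionals $x\mapsto\langle\tau((\rho_{i,j}\rtimes\pi_j)(x))\eta,\eta\rangle$. -/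

import Mathlib

open scoped ENNReal

universe u v w

noncomputable section

/-! ## Unitary representations of a discrete group and its unitary dual -/

/-- A unitary representation of the discrete group `G` on a complex Hilbert space. -/
structure UnitaryRep (G : Type u) [Group G] : Type (u + 1) where
  /-- the Hilbert space -/
  H : Type u
  [normed : NormedAddCommGroup H]
  [inner : InnerProductSpace ℂ H]
  [complete : CompleteSpace H]
  /-- the representation -/
  hom : G →* unitary (H →L[ℂ] H)

namespace UnitaryRep

attribute [instance] UnitaryRep.normed UnitaryRep.inner UnitaryRep.complete

variable {G : Type u} [Group G]

/-- The operator by which a group element acts. -/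
def op (π : UnitaryRep G) (g : G) : π.H →L[ℂ] π.H := (π.hom g : π.H →L[ℂ] π.H)

/-- Irreducibility: the space is nonzero and has no closed invariant subspace besides the two
trivial ones. -/
def IsIrreducible (π : UnitaryRep G) : Prop :=
  Nontrivial π.H ∧ ∀ K : Submodule ℂ π.H, IsClosed (K : Set π.H) →
    (∀ g : G, ∀ x ∈ K, π.op g x ∈ K) → K = ⊥ ∨ K = ⊤

/-- Unitary equivalence of representations. -/
def Equivalent (π ρ : UnitaryRep G) : Prop :=
  ∃ U : π.H ≃ₗᵢ[ℂ] ρ.H, ∀ (g : G) (x : π.H), U (π.op g x) = ρ.op g (U x)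

/-- The function of positive type `g ↦ ⟨π(g)ξ, ξ⟩` associated to `π` (in Mathlib the inner product
is linear in its second argument). -/
def coeff (π : UnitaryRep G) (ξ : π.H) (g : G) : ℂ := Inner.inner ℂ ξ (π.op g ξ)

end UnitaryRep

/-- Irreducible unitary representations of `G`. -/
def IrreducibleRep (G : Type u) [Group G] : Type (u + 1) :=
  {π : UnitaryRep G // π.IsIrreducible}

namespace IrreducibleRep

variable {G : Type u} [Group G]

/-- The basic sets `W(π, φ₁, …, φₙ, Q, ε)` of Fell's topology: the representations `ρ` such that
each of the given functions of positive type `φₖ = ⟨π(·)ξₖ, ξₖ⟩` associated to `π` is, on the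
finite set `Q` and up to `ε`, a sum of functions of positive type associated to `ρ`. -/
def fellNhd (π : IrreducibleRep G) {n : ℕ} (ξ : Fin n → π.1.H) (Q : Finset G) (ε : ℝ) :
    Set (IrreducibleRep G) :=
  {ρ | ∀ k : Fin n, ∃ (m : ℕ) (η : Fin m → ρ.1.H), ∀ g ∈ Q,
    ‖π.1.coeff (ξ k) g - ∑ l, ρ.1.coeff (η l) g‖ < ε}

/-- Fell's topology. -/
instance : TopologicalSpace (IrreducibleRep G) :=
  TopologicalSpace.generateFrom
    {W | ∃ (π : IrreducibleRep G) (n : ℕ) (ξ : Fin n → π.1.H) (Q : Finset G) (ε : ℝ),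
      0 < ε ∧ W = fellNhd π ξ Q ε}

/-- Unitary equivalence on irreducible representations. -/
instance equivalence : Setoid (IrreducibleRep G) where
  r π ρ := UnitaryRep.Equivalent π.1 ρ.1
  iseqv :=
    { refl := fun π => ⟨LinearIsometryEquiv.refl ℂ π.1.H, fun _ _ => rfl⟩
      symm := by
        rintro π ρ ⟨U, hU⟩
        refine ⟨U.symm, fun g x => ?_⟩
        rw [LinearIsometryEquiv.symm_apply_eq, hU, LinearIsometryEquiv.apply_symm_apply]
      trans := by
        rintro π ρ σ ⟨U, hU⟩ ⟨V, hV⟩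
        exact ⟨U.trans V, fun g x => by simp [hU, hV]⟩ }

end IrreducibleRep

/-- The unitary dual of `G`: unitary equivalence classes of irreducible unitary representations,
with Fell's topology. -/
def UnitaryDual (G : Type u) [Group G] : Type (u + 1) :=
  Quotient (IrreducibleRep.equivalence (G := G))

instance (G : Type u) [Group G] : TopologicalSpace (UnitaryDual G) :=
  inferInstanceAs (TopologicalSpace (Quotient (IrreducibleRep.equivalence (G := G))))

/-- The family of quotients `G / N κ` is an FD family: the (classes of) irreducible representations
that factor through one of the quotient maps `G → G / N κ` are dense in the unitary dual. -/
def IsFDFamily {G : Type u} [Group G] {ι : Type v} (N : ι → Subgroup G) : Prop :=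
  Dense {c : UnitaryDual G | ∃ (κ : ι) (π : IrreducibleRep G),
    Quotient.mk _ π = c ∧ N κ ≤ π.1.hom.ker}

/-! ## The maximal crossed product of a unital C⋆-algebra by a discrete group -/

/-- A covariant representation of the C⋆-dynamical system `(A, G, α)` on a nonzero Hilbert space. -/
structure CovariantRep {A G : Type u} [CStarAlgebra A] [Group G] (α : G →* (A ≃⋆ₐ[ℂ] A)) :
    Type (u + 1) where
  /-- the Hilbert space -/
  H : Type u
  [normed : NormedAddCommGroup H]
  [inner : InnerProductSpace ℂ H]
  [complete : CompleteSpace H]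
  [nontrivial : Nontrivial H]
  /-- the representation of the algebra -/
  alg : A →⋆ₐ[ℂ] (H →L[ℂ] H)
  /-- the representation of the group -/
  grp : G →* unitary (H →L[ℂ] H)
  covariant : ∀ (g : G) (a : A),
    (grp g : H →L[ℂ] H) * alg a * star (grp g : H →L[ℂ] H) = alg (α g a)

attribute [instance] CovariantRep.normed CovariantRep.inner CovariantRep.complete
  CovariantRep.nontrivial

namespace CrossedProduct

section Basic

variable {A G : Type u} [CStarAlgebra A] [Group G] (α : G →* (A ≃⋆ₐ[ℂ] A))

/-- The `ℓ^∞`-product of the algebras `B(H)`, over all covariant representations on spaces `H`. It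
contains the block diagonal operators on the direct sum of all these spaces. -/
abbrev Ambient : Type (u + 1) := lp (fun r : CovariantRep α => r.H →L[ℂ] r.H) ∞

instance : CStarAlgebra (Ambient α) where

/-- The element of the algebra in the universal covariant representation. -/
def ambientAlg (a : A) : Ambient α :=
  ⟨fun r : CovariantRep α => r.alg a, memℓp_infty ⟨‖a‖, by
    rintro _ ⟨r, rfl⟩
    exact NonUnitalStarAlgHom.norm_apply_le r.alg a⟩⟩

/-- The group element in the universal covariant representation. -/
def ambientGrp (g : G) : Ambient α :=
  ⟨fun r : CovariantRep α => (r.grp g : r.H →L[ℂ] r.H), memℓp_infty ⟨1, by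
    rintro _ ⟨r, rfl⟩
    exact (CStarRing.norm_of_mem_unitary (r.grp g).2).le⟩⟩

/-- The image of the algebraic crossed product under the universal covariant representation. -/
def algebraicPart : StarSubalgebra ℂ (Ambient α) :=
  StarAlgebra.adjoin ℂ (Set.range (ambientAlg α) ∪ Set.range (ambientGrp α))

end Basic

end CrossedProduct

/-- The maximal crossed product `A ⋊ G`: the C⋆-algebra generated by `A` and `G` in the universal
covariant representation. Thus the norm of an element of the algebraic crossed product is the
supremum of its norms in all covariant representations. -/
def CrossedProduct {A G : Type u} [CStarAlgebra A] [Group G] (α : G →* (A ≃⋆ₐ[ℂ] A)) :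
    Type (u + 1) :=
  (CrossedProduct.algebraicPart α).topologicalClosure

namespace CrossedProduct

variable {A G : Type u} [CStarAlgebra A] [Group G] (α : G →* (A ≃⋆ₐ[ℂ] A))

instance : CStarAlgebra (CrossedProduct α) :=
  StarSubalgebra.cstarAlgebra (algebraicPart α).topologicalClosure
    (h_closed := StarSubalgebra.isClosed_topologicalClosure _)

/-- The canonical copy of `a : A` in `A ⋊ G`. -/
def ofAlg (a : A) : CrossedProduct α :=
  ⟨ambientAlg α a, StarSubalgebra.le_topologicalClosure _
    (StarAlgebra.subset_adjoin ℂ _ (Or.inl ⟨a, rfl⟩))⟩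

/-- The canonical unitary of `g : G` in `A ⋊ G`. -/
def ofGrp (g : G) : CrossedProduct α :=
  ⟨ambientGrp α g, StarSubalgebra.le_topologicalClosure _
    (StarAlgebra.subset_adjoin ℂ _ (Or.inr ⟨g, rfl⟩))⟩

section Functoriality

variable {α} {B K : Type u} [CStarAlgebra B] [Group K] {β : K →* (B ≃⋆ₐ[ℂ] B)}
  (ρ : A →⋆ₐ[ℂ] B) (φ : G →* K) (h : ∀ (g : G) (a : A), ρ (α g a) = β (φ g) (ρ a))

/-- The pullback of a covariant representation along an equivariant pair of homomorphisms. -/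
def pullbackRep (r : CovariantRep β) : CovariantRep α where
  H := r.H
  alg := r.alg.comp ρ
  grp := r.grp.comp φ
  covariant g a := by
    simp only [MonoidHom.comp_apply, StarAlgHom.comp_apply, r.covariant, h]

/-- The map on the ambient products that an equivariant pair induces by pullback. -/
def ambientMap : Ambient α →⋆ₐ[ℂ] Ambient β where
  toFun x := ⟨fun r => x (pullbackRep ρ φ h r), memℓp_infty ⟨‖x‖, by
    rintro _ ⟨r, rfl⟩
    exact lp.norm_apply_le_norm ENNReal.top_ne_zero x (pullbackRep ρ φ h r)⟩⟩
  map_one' := rfl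
  map_mul' _ _ := rfl
  map_zero' := rfl
  map_add' _ _ := rfl
  commutes' _ := rfl
  map_star' _ := rfl

lemma ambientMap_mem (x : CrossedProduct α) :
    ambientMap ρ φ h x.1 ∈ (algebraicPart β).topologicalClosure := by
  have hcont : Continuous (ambientMap ρ φ h) :=
    AddMonoidHomClass.continuous_of_bound (ambientMap ρ φ h) 1 (fun x => by
      simpa only [one_mul] using! NonUnitalStarAlgHom.norm_apply_le (ambientMap ρ φ h) x)
  have hle : algebraicPart α ≤
      ((algebraicPart β).topologicalClosure).comap (ambientMap ρ φ h) := by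
    refine StarAlgebra.adjoin_le ?_
    rintro _ (⟨a, rfl⟩ | ⟨g, rfl⟩)
    · exact (ofAlg β (ρ a)).2
    · exact (ofGrp β (φ g)).2
  exact StarSubalgebra.topologicalClosure_minimal hle
    ((StarSubalgebra.isClosed_topologicalClosure _).preimage hcont) x.2

/-- The homomorphism `ρ ⋊ φ : A ⋊ G → B ⋊ K` of maximal crossed products that is induced by a
homomorphism `ρ : A → B` which is equivariant along `φ : G → K`. -/
def map : CrossedProduct α →⋆ₐ[ℂ] CrossedProduct β :=
  StarAlgHom.codRestrict
    ((ambientMap ρ φ h).comp (algebraicPart α).topologicalClosure.subtype)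
    (algebraicPart β).topologicalClosure (ambientMap_mem ρ φ h)

lemma map_ofAlg (a : A) : map ρ φ h (ofAlg α a) = ofAlg β (ρ a) := rfl

lemma map_ofGrp (g : G) : map ρ φ h (ofGrp α g) = ofGrp β (φ g) := rfl

end Functoriality

end CrossedProduct

/-- A family of homomorphisms of C⋆-algebras as one homomorphism into the `ℓ^∞`-product, which is
the product of C⋆-algebras. -/
def productHom {A : Type v} [CStarAlgebra A] {ι : Type w} {B : ι → Type v}
    [∀ j, CStarAlgebra (B j)] (φ : ∀ j, A →⋆ₐ[ℂ] B j) : A →⋆ₙₐ[ℂ] lp B ∞ where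
  toFun x := ⟨fun j => φ j x, memℓp_infty ⟨‖x‖, by
    rintro _ ⟨j, rfl⟩
    exact NonUnitalStarAlgHom.norm_apply_le (φ j) x⟩⟩
  map_smul' c x := by ext j; exact map_smul (φ j) c x
  map_zero' := by ext j; exact map_zero (φ j)
  map_add' x y := by ext j; exact map_add (φ j) x y
  map_mul' x y := by ext j; exact map_mul (φ j) x y
  map_star' x := by ext j; exact map_star (φ j) x

/-! ## Representations of C⋆-algebras and weak containment -/

/-- A (unital, that is, nondegenerate) representation of a unital C⋆-algebra on a Hilbert space. -/
structure CStarRep (A : Type v) [CStarAlgebra A] : Type (max v (w + 1)) where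
  /-- the Hilbert space -/
  H : Type w
  [normed : NormedAddCommGroup H]
  [inner : InnerProductSpace ℂ H]
  [complete : CompleteSpace H]
  /-- the representation -/
  hom : A →⋆ₐ[ℂ] (H →L[ℂ] H)

namespace CStarRep

attribute [instance] CStarRep.normed CStarRep.inner CStarRep.complete

variable {A : Type v} [CStarAlgebra A]

/-- The positive functional `a ↦ ⟨σ(a)ξ, ξ⟩` associated to `σ`. -/
def coeff (σ : CStarRep.{v, w} A) (ξ : σ.H) (a : A) : ℂ := Inner.inner ℂ ξ (σ.hom a ξ)

/-- The representation `τ ∘ φ`. -/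
def comp {B : Type v} [CStarAlgebra B] (τ : CStarRep.{v, w} B) (φ : A →⋆ₐ[ℂ] B) :
    CStarRep.{v, w} A where
  H := τ.H
  hom := τ.hom.comp φ

/-- `σ` is weakly contained in the set `S` of representations: every positive functional associated
to `σ` is a pointwise (weak-*) limit of finite sums of positive functionals associated to members
of `S`. -/
def WeaklyContained (σ : CStarRep.{v, w} A) (S : Set (CStarRep.{v, u} A)) : Prop :=
  ∀ (ξ : σ.H) (F : Finset A) (ε : ℝ), 0 < ε →
    ∃ (m : ℕ) (τ : Fin m → CStarRep.{v, u} A) (η : ∀ l, (τ l).H),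
      (∀ l, τ l ∈ S) ∧ ∀ a ∈ F, ‖σ.coeff ξ a - ∑ l, (τ l).coeff (η l) a‖ < ε

end CStarRep

/-! ## The function algebras on the finite quotients -/

instance quotientFintype {Γ : Type u} [Group Γ] (N : Subgroup Γ) [N.FiniteIndex] :
    Fintype (Γ ⧸ N) :=
  Subgroup.fintypeQuotientOfFiniteIndex

/-- The action of `G` on functions on a `G`-set by left translation, `(g · f)(x) = f(g⁻¹ x)`. It
sends the indicator function of `x` to that of `g x`. -/
def translation (G X : Type u) [Group G] [MulAction G X] : G →* ((X → ℂ) ≃⋆ₐ[ℂ] (X → ℂ)) where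
  toFun g :=
    { toFun := fun f x => f (g⁻¹ • x)
      invFun := fun f x => f (g • x)
      left_inv := fun f => by funext x; simp
      right_inv := fun f => by funext x; simp
      map_mul' := fun _ _ => rfl
      map_add' := fun _ _ => rfl
      map_star' := fun _ => rfl
      map_smul' := fun _ _ => rfl }
  map_one' := by ext f x; simp
  map_mul' g h := by
    ext f x
    change f ((g * h)⁻¹ • x) = f (h⁻¹ • g⁻¹ • x)
    rw [mul_inv_rev, mul_smul]

/-- Composition with a map `p : Y → X`. It sends the indicator function of `x` to the sum of the
indicator functions of the points `y` with `p y = x`. -/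
def pullbackFun {X Y : Type u} (p : Y → X) : (X → ℂ) →⋆ₐ[ℂ] (Y → ℂ) where
  toFun f y := f (p y)
  map_one' := rfl
  map_mul' _ _ := rfl
  map_zero' := rfl
  map_add' _ _ := rfl
  commutes' _ := rfl
  map_star' _ := rfl

namespace FDFamily

variable {Γ : Type u} [Group Γ] (N : ℕ → Subgroup Γ) [∀ i, (N i).Normal]

/-- The algebra `A_i` of functions on the finite set `X_i = Γ / N_i`, with the supremum norm. Its
minimal projections `p_{i,g}` are the indicator functions of the points `g` of `X_i`. -/
abbrev Alg (i : ℕ) : Type u := (Γ ⧸ N i) → ℂ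

/-- The canonical map `Γ / N_j → Γ / N_i`, for `i ≤ j`. -/
def proj (hN : Antitone N) {i j : ℕ} (hij : i ≤ j) : (Γ ⧸ N j) →* (Γ ⧸ N i) :=
  QuotientGroup.map (N j) (N i) (MonoidHom.id Γ) (hN hij)

/-- The map `ρ_{i,j} : A_i → A_j`, which sends `p_{i,g}` to the sum of the `p_{j,g'}` over the `g'`
that lie above `g`. -/
def rho (hN : Antitone N) {i j : ℕ} (hij : i ≤ j) : Alg N i →⋆ₐ[ℂ] Alg N j :=
  pullbackFun (proj N hN hij)

lemma rho_equivariant (hN : Antitone N) {i j : ℕ} (hij : i ≤ j) (g : Γ) (f : Alg N i) :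
    rho N hN hij (translation Γ (Γ ⧸ N i) g f) =
      translation (Γ ⧸ N j) (Γ ⧸ N j) (QuotientGroup.mk' (N j) g) (rho N hN hij f) := by
  funext x
  induction x using QuotientGroup.induction_on with
  | H x => rfl

variable [∀ i, (N i).FiniteIndex]

/-- The maximal crossed product `A_i ⋊ Γ`. -/
abbrev FullLevel (i : ℕ) : Type (u + 1) := CrossedProduct (A := Alg N i) (translation Γ (Γ ⧸ N i))

/-- The crossed product `A_j ⋊ Γ / N_j`. -/
abbrev FiniteLevel (j : ℕ) : Type (u + 1) :=
  CrossedProduct (A := Alg N j) (translation (Γ ⧸ N j) (Γ ⧸ N j))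

/-- The natural map `ρ_{i,j} ⋊ π_j : A_i ⋊ Γ → A_j ⋊ Γ / N_j`. -/
def natMap (hN : Antitone N) {i j : ℕ} (hij : i ≤ j) : FullLevel N i →⋆ₐ[ℂ] FiniteLevel N j :=
  CrossedProduct.map (rho N hN hij) (QuotientGroup.mk' (N j)) (rho_equivariant N hN hij)

end FDFamily

end

/-!
Restricted to the dense span of the products `f · u_g` of a function on `X = Γ / N_i` and a group
element, a positive functional of `A_i ⋊ Γ` has the form
`f · u_g ↦ ∑ x, f x * ⟨ξ_x, U(g) ξ_{g⁻¹ x}⟩`, where `U` is a unitary representation of `Γ` and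
`ξ_x` is the component of the given vector under the projection `p_x`
(`CrossedProduct.coeff_ofAlg_mul_ofGrp`). So it suffices to approximate the matrix coefficients
`⟨ξ_x, U(g) ξ_y⟩` of a finite family of vectors by sums of matrix coefficients of representations
of the finite quotients, and to realize the latter at the finite levels.

For the approximation, start from a single vector. The normalized functions of positive type form a
compact convex set; by the Gelfand–Naimark–Segal construction its extreme points are coefficients of
irreducible representations (`exists_irreducible_of_mem_extremePoints`). Those are limits of sums of
coefficients of finite quotients by density in Fell's topology
(`IsFDFamily.coeff_mem_coeffCone`), and the Krein–Milman theorem extends this to all functions of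
positive type (`IsPositiveType.mem_coeffCone`). For vectors in a cyclic subspace the matrix
coefficients are obtained from the coefficient at the cyclic vector by a continuous linear map, and
an arbitrary finite family splits into its components in finitely many orthogonal cyclic subspaces
(`matrixCoeff_mem`).

For the realization, let `τ` be a representation of `Γ / N_j` on `H`, with `j ≥ i`, and `η` a family
of vectors indexed by `Γ / N_i`. On the functions `Γ / N_j → H`, with the multiplication operators
and `τ` tensored with the left regular representation, the pullback of `η` along
`Γ / N_j → Γ / N_i`, suitably normalized, is a vector with the required functional
(`FDFamily.exists_finiteLevelRep`).

Convergence on a total set of elements, among them the identity, implies pointwise convergence of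
positive functionals, because their norms are their values at the identity
(`CStarRep.tendsto_of_total`). This gives weak containment, and weak containment bounds the norm of
`σ(x)` by the norms at the finite levels on testing at `x⋆ x`
(`CStarRep.WeaklyContained.norm_hom_le`), whence the isometry.
-/

noncomputable section

open Filter Topology

/-! ### Functions of positive type -/

section PositiveType

variable {G : Type u} [Group G]

/-- A function of positive type on a discrete group: `φ(g⁻¹)` is the conjugate of `φ(g)`, and the
kernel `(s, t) ↦ φ(s⁻¹ t)` is positive semidefinite. -/
def IsPositiveType (φ : G → ℂ) : Prop :=
  (∀ g, φ g⁻¹ = star (φ g)) ∧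
    ∀ c : G →₀ ℂ, 0 ≤ (c.sum fun s a => c.sum fun t b => star a * b * φ (s⁻¹ * t)).re

section Hom

variable {H : Type w} [NormedAddCommGroup H] [InnerProductSpace ℂ H] [CompleteSpace H]

lemma unitaryHom_inner_mul (U : G →* unitary (H →L[ℂ] H)) (s t : G) (ξ η : H) :
    inner ℂ ((U s : H →L[ℂ] H) ξ) ((U t : H →L[ℂ] H) η) =
      inner ℂ ξ ((U (s⁻¹ * t) : H →L[ℂ] H) η) := by
  have h : ((U (s⁻¹ * t) : H →L[ℂ] H)) = star (U s : H →L[ℂ] H) * (U t : H →L[ℂ] H) := by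
    rw [map_mul, map_inv]; rfl
  rw [h, ContinuousLinearMap.star_eq_adjoint, mul_apply_eq_comp,
    ContinuousLinearMap.adjoint_inner_right]

lemma unitaryHom_inner_left (U : G →* unitary (H →L[ℂ] H)) (g : G) (ξ η : H) :
    inner ℂ ((U g : H →L[ℂ] H) ξ) η = inner ℂ ξ ((U g⁻¹ : H →L[ℂ] H) η) := by
  simpa using unitaryHom_inner_mul U g 1 ξ η

lemma unitaryHom_mul_apply (U : G →* unitary (H →L[ℂ] H)) (g h : G) (ξ : H) :
    (U (g * h) : H →L[ℂ] H) ξ = (U g : H →L[ℂ] H) ((U h : H →L[ℂ] H) ξ) := by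
  rw [map_mul]; rfl

lemma unitaryHom_one_apply (U : G →* unitary (H →L[ℂ] H)) (ξ : H) :
    (U 1 : H →L[ℂ] H) ξ = ξ := by
  rw [map_one]; rfl

lemma unitaryHom_norm_apply (U : G →* unitary (H →L[ℂ] H)) (g : G) (ξ : H) :
    ‖(U g : H →L[ℂ] H) ξ‖ = ‖ξ‖ := by
  have h := unitaryHom_inner_mul U g g ξ ξ
  rw [inv_mul_cancel, unitaryHom_one_apply, inner_self_eq_norm_sq_to_K,
    inner_self_eq_norm_sq_to_K] at h
  have h2 : ‖(U g : H →L[ℂ] H) ξ‖ ^ 2 = ‖ξ‖ ^ 2 := by exact_mod_cast h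
  exact (sq_eq_sq₀ (norm_nonneg _) (norm_nonneg _)).1 h2

lemma isPositiveType_coeff (U : G →* unitary (H →L[ℂ] H)) (ξ : H) :
    IsPositiveType fun g => inner ℂ ξ ((U g : H →L[ℂ] H) ξ) := by
  refine ⟨fun g => ?_, fun c => ?_⟩
  · change inner ℂ ξ ((U g⁻¹ : H →L[ℂ] H) ξ) = _
    rw [← unitaryHom_inner_left, ← inner_conj_symm]; rfl
  · have h : (c.sum fun s a => c.sum fun t b =>
        star a * b * inner ℂ ξ ((U (s⁻¹ * t) : H →L[ℂ] H) ξ)) =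
        inner ℂ (c.sum fun s a => a • (U s : H →L[ℂ] H) ξ)
          (c.sum fun s a => a • (U s : H →L[ℂ] H) ξ) := by
      simp only [Finsupp.sum, sum_inner]
      refine Finset.sum_congr rfl fun s _ => ?_
      rw [inner_sum]
      refine Finset.sum_congr rfl fun t _ => ?_
      rw [inner_smul_left, inner_smul_right, unitaryHom_inner_mul, starRingEnd_apply]
      ring
    rw [h]
    exact inner_self_nonneg (𝕜 := ℂ)

end Hom

/-- Moore's theorem for the kernel `(s, t) ↦ φ(s⁻¹ t)`. -/
lemma IsPositiveType.exists_kernelSpace {φ : G → ℂ} (hφ : IsPositiveType φ) :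
    ∃ (H : Type u) (_ : NormedAddCommGroup H) (_ : InnerProductSpace ℂ H) (_ : CompleteSpace H)
      (k : G → H), (∀ s t, inner ℂ (k s) (k t) = φ (s⁻¹ * t)) ∧
        (Submodule.span ℂ (Set.range k)).topologicalClosure = ⊤ := by
  let K : Matrix G G (ℂ →L[ℂ] ℂ) := fun s t => φ (s⁻¹ * t) • (1 : ℂ →L[ℂ] ℂ)
  have hK : K.PosSemidef := by
    refine (RKHS.posSemidef_tfae.out 0 2).2 (And.intro ?_ fun c => ?_)
    · ext s t
      have := hφ.1 (t⁻¹ * s)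
      simp only [mul_inv_rev, inv_inv] at this
      rw [Matrix.conjTranspose_apply]
      simp [K, this]
    · have h := hφ.2 c
      rw [Finsupp.sum_comm] at h
      have e : (c.sum fun x w => c.sum fun x' w' => inner ℂ (K x' x w) w') =
          star (c.sum fun s a => c.sum fun t b => star b * a * φ (t⁻¹ * s)) := by
        simp only [Finsupp.sum, star_sum]
        refine Finset.sum_congr rfl fun s _ => ?_
        refine Finset.sum_congr rfl fun t _ => ?_
        simp [K]; ring
      rw [e]
      change 0 ≤ (star _ : ℂ).re
      rw [Complex.star_def, Complex.conj_re]
      exact h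
  have : Fact K.PosSemidef := ⟨hK⟩
  refine ⟨RKHS.OfKernel K, inferInstance, inferInstance, inferInstance,
    fun t => RKHS.kerFun (RKHS.OfKernel K) t (1 : ℂ), fun s t => ?_, ?_⟩
  · rw [RKHS.kerFun_inner, RKHS.kerFun_apply, RKHS.OfKernel.kernel_ofKernel]
    simp [K]
  · rw [eq_top_iff, ← RKHS.kerFun_dense (𝕜 := ℂ) (X := G) (V := ℂ) (RKHS.OfKernel K)]
    refine Submodule.topologicalClosure_mono (Submodule.span_le.2 ?_)
    rintro _ ⟨t, c, rfl⟩
    have : RKHS.kerFun (RKHS.OfKernel K) t c = c • RKHS.kerFun (RKHS.OfKernel K) t (1 : ℂ) := by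
      rw [← map_smul, smul_eq_mul, mul_one]
    rw [SetLike.mem_coe, this]
    exact Submodule.smul_mem _ _ (Submodule.subset_span ⟨t, rfl⟩)

/-- A total family of vectors indexed by `G` whose Gram matrix is invariant under left translation
is an orbit of a unitary representation. -/
lemma exists_unitaryHom_of_kernel {H : Type w} [NormedAddCommGroup H] [InnerProductSpace ℂ H]
    [CompleteSpace H] {k : G → H}
    (hk : ∀ g s t, inner ℂ (k (g * s)) (k (g * t)) = inner ℂ (k s) (k t))
    (hspan : (Submodule.span ℂ (Set.range k)).topologicalClosure = ⊤) :
    ∃ U : G →* unitary (H →L[ℂ] H), ∀ g t, (U g : H →L[ℂ] H) (k t) = k (g * t) := by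
  let e : (G →₀ ℂ) →ₗ[ℂ] H := Finsupp.linearCombination ℂ k
  have hdense : DenseRange e := by
    rw [← Submodule.dense_iff_topologicalClosure_eq_top] at hspan
    rw [DenseRange, ← LinearMap.coe_range, Finsupp.range_linearCombination]
    exact hspan
  let T : G → ((G →₀ ℂ) ≃ₗ[ℂ] (G →₀ ℂ)) := fun g => Finsupp.domLCongr (Equiv.mulLeft g)
  have hT : ∀ g c, e (T g c) = c.sum fun t a => a • k (g * t) := by
    intro g c
    simp [e, T, Finsupp.linearCombination_apply, Finsupp.domLCongr_apply,
      Finsupp.equivMapDomain_eq_mapDomain, Finsupp.sum_mapDomain_index, add_smul]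
  have hnorm : ∀ g c, ‖e (T g c)‖ = ‖e c‖ := by
    intro g c
    have h : inner ℂ (e (T g c)) (e (T g c)) = inner ℂ (e c) (e c) := by
      rw [hT]
      simp only [e, Finsupp.linearCombination_apply, Finsupp.sum, sum_inner, inner_sum,
        inner_smul_left, inner_smul_right, hk]
    rw [inner_self_eq_norm_sq_to_K, inner_self_eq_norm_sq_to_K] at h
    have h2 : ‖e (T g c)‖ ^ 2 = ‖e c‖ ^ 2 := by exact_mod_cast h
    exact (sq_eq_sq₀ (norm_nonneg _) (norm_nonneg _)).1 h2
  let V : G → (H ≃ₗᵢ[ℂ] H) := fun g => (T g).extendOfIsometry e e hdense hdense (hnorm g)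
  have hV : ∀ g t, V g (k t) = k (g * t) := by
    intro g t
    have h := LinearEquiv.extendOfIsometry_eq (T g) e e hdense hdense (hnorm g) (Finsupp.single t 1)
    rw [hT] at h
    simpa [e] using h
  have hext : ∀ A B : H →L[ℂ] H, (∀ t, A (k t) = B (k t)) → A = B := by
    intro A B h
    have hd := Submodule.dense_iff_topologicalClosure_eq_top.2 hspan
    refine ContinuousLinearMap.ext_on hd ?_
    rintro _ ⟨t, rfl⟩
    exact h t
  let U : G →* (H ≃ₗᵢ[ℂ] H) :=
    { toFun := V
      map_one' := by
        ext x
        have := hext (V 1 : H ≃L[ℂ] H) (ContinuousLinearMap.id ℂ H) fun t => by simp [hV]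
        exact congrArg (fun A => A x) this
      map_mul' := fun g h => by
        ext x
        have := hext (V (g * h) : H ≃L[ℂ] H) ((V g : H →L[ℂ] H) ∘L (V h : H →L[ℂ] H)) fun t => by
          simp [hV, mul_assoc]
        exact congrArg (fun A => A x) this }
  exact ⟨Unitary.linearIsometryEquiv.symm.toMonoidHom.comp U, fun g t => hV g t⟩

/-- The Gelfand–Naimark–Segal construction for groups: a function of positive type is a coefficient
of a unitary representation at a cyclic vector. -/
theorem IsPositiveType.exists_cyclic {φ : G → ℂ} (hφ : IsPositiveType φ) :
    ∃ (π : UnitaryRep G) (ξ : π.H), π.coeff ξ = φ ∧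
      (Submodule.span ℂ (Set.range fun g => π.op g ξ)).topologicalClosure = ⊤ := by
  obtain ⟨H, _, _, _, k, hk, hspan⟩ := hφ.exists_kernelSpace
  obtain ⟨U, hU⟩ := exists_unitaryHom_of_kernel (k := k)
    (fun g s t => by rw [hk, hk]; congr 1; group) hspan
  have hξ : ∀ g, (U g : H →L[ℂ] H) (k 1) = k g := fun g => by rw [hU, mul_one]
  refine ⟨⟨H, U⟩, k 1, ?_, ?_⟩
  · funext g
    change inner ℂ (k 1) ((U g : H →L[ℂ] H) (k 1)) = φ g
    rw [hξ, hk, inv_one, one_mul]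
  · change (Submodule.span ℂ (Set.range fun g => (U g : H →L[ℂ] H) (k 1))).topologicalClosure = ⊤
    simp only [hξ]
    exact hspan


lemma IsPositiveType.norm_apply_le {φ : G → ℂ} (hφ : IsPositiveType φ) (g : G) :
    ‖φ g‖ ≤ (φ 1).re := by
  obtain ⟨π, ξ, rfl, -⟩ := hφ.exists_cyclic
  have h1 : π.coeff ξ 1 = (‖ξ‖ : ℂ) ^ 2 := by
    rw [UnitaryRep.coeff, UnitaryRep.op, unitaryHom_one_apply, inner_self_eq_norm_sq_to_K]; rfl
  rw [h1, ← Complex.ofReal_pow, Complex.ofReal_re, sq]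
  refine (norm_inner_le_norm _ _).trans ?_
  rw [UnitaryRep.op, unitaryHom_norm_apply]

lemma IsPositiveType.add {φ ψ : G → ℂ} (hφ : IsPositiveType φ) (hψ : IsPositiveType ψ) :
    IsPositiveType (φ + ψ) := by
  refine ⟨fun g => by simp [hφ.1 g, hψ.1 g], fun c => ?_⟩
  have h := add_nonneg (hφ.2 c) (hψ.2 c)
  rw [← Complex.add_re, ← Finsupp.sum_add] at h
  simpa only [← Finsupp.sum_add, ← mul_add, Pi.add_apply] using h

lemma IsPositiveType.smul {φ : G → ℂ} (hφ : IsPositiveType φ) {r : ℝ} (hr : 0 ≤ r) :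
    IsPositiveType (r • φ) := by
  refine ⟨fun g => by simp [hφ.1 g], fun c => ?_⟩
  have h := mul_nonneg hr (hφ.2 c)
  rw [← Complex.re_ofReal_mul] at h
  convert! h using 2
  simp only [Finsupp.mul_sum, Pi.smul_apply, Complex.real_smul]
  refine Finsupp.sum_congr fun s _ => Finsupp.sum_congr fun t _ => ?_
  ring

variable (G) in
/-- The functions of positive type with value `1` at the identity: the state space of the group. -/
def normalizedPositiveType : Set (G → ℂ) := {φ | IsPositiveType φ ∧ φ 1 = 1}

lemma convex_normalizedPositiveType : Convex ℝ (normalizedPositiveType G) := by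
  rintro φ ⟨hφ, hφ1⟩ ψ ⟨hψ, hψ1⟩ a b ha hb hab
  refine ⟨(hφ.smul ha).add (hψ.smul hb), ?_⟩
  simp only [Pi.add_apply, Pi.smul_apply, hφ1, hψ1, Complex.real_smul, mul_one]
  exact_mod_cast hab

lemma isCompact_normalizedPositiveType : IsCompact (normalizedPositiveType G) := by
  have hK : IsCompact (Set.univ.pi fun _ : G => Metric.closedBall (0 : ℂ) 1) :=
    isCompact_univ_pi fun _ => isCompact_closedBall _ _
  refine hK.of_isClosed_subset ?_ ?_
  · have h1 : IsClosed {φ : G → ℂ | ∀ g, φ g⁻¹ = star (φ g)} := by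
      simp only [Set.ofPred_forall]
      exact isClosed_iInter fun g => isClosed_eq (by fun_prop) (by fun_prop)
    have h2 : IsClosed {φ : G → ℂ | ∀ c : G →₀ ℂ,
        0 ≤ (c.sum fun s a => c.sum fun t b => star a * b * φ (s⁻¹ * t)).re} := by
      simp only [Set.ofPred_forall]
      refine isClosed_iInter fun c => isClosed_le continuous_const ?_
      refine Complex.continuous_re.comp ?_
      simp only [Finsupp.sum]
      fun_prop
    have h3 : IsClosed {φ : G → ℂ | φ 1 = 1} := isClosed_eq (by fun_prop) (by fun_prop)
    exact (h1.inter h2).inter h3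
  · rintro φ ⟨hφ, hφ1⟩ g -
    have := hφ.norm_apply_le g
    rw [hφ1, Complex.one_re] at this
    simpa using this

/-- An extreme normalized function of positive type is a coefficient of an irreducible
representation: an invariant subspace of the cyclic representation splits the function into the
coefficients at the two projections of the cyclic vector. -/
theorem exists_irreducible_of_mem_extremePoints {φ : G → ℂ}
    (hφ : φ ∈ (normalizedPositiveType G).extremePoints ℝ) :
    ∃ (π : UnitaryRep G) (ξ : π.H), π.IsIrreducible ∧ π.coeff ξ = φ := by
  obtain ⟨⟨hpos, h1⟩, hext⟩ := hφ
  obtain ⟨π, ξ, rfl, hcyc⟩ := hpos.exists_cyclic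
  have hone : ∀ ζ, π.coeff ζ 1 = (‖ζ‖ : ℂ) ^ 2 := by
    intro ζ
    rw [UnitaryRep.coeff, UnitaryRep.op, unitaryHom_one_apply, inner_self_eq_norm_sq_to_K]; rfl
  have hξ : ‖ξ‖ ^ 2 = 1 := by rw [hone] at h1; exact_mod_cast h1
  have hξ0 : ξ ≠ 0 := by rintro rfl; simp at hξ
  refine ⟨π, ξ, ⟨⟨ξ, 0, hξ0⟩, fun K hK hinv => ?_⟩, rfl⟩
  have : CompleteSpace K := hK.completeSpace_coe
  -- the orthogonal complement is invariant as well
  have hinv' : ∀ g, ∀ x ∈ Kᗮ, π.op g x ∈ Kᗮ := by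
    intro g x hx y hy
    have h := unitaryHom_inner_mul π.hom g⁻¹ 1 y x
    simp only [unitaryHom_one_apply, inv_inv, mul_one] at h
    exact h.symm.trans (hx _ (hinv g⁻¹ y hy))
  have htop : ∀ L : Submodule ℂ π.H, IsClosed (L : Set π.H) →
      (∀ g, ∀ x ∈ L, π.op g x ∈ L) → ξ ∈ L → L = ⊤ := by
    intro L hL hLinv hξL
    rw [eq_top_iff, ← hcyc]
    refine Submodule.topologicalClosure_minimal _ (Submodule.span_le.2 ?_) hL
    rintro _ ⟨g, rfl⟩
    exact hLinv g ξ hξL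
  set p : π.H := K.starProjection ξ with hp
  set q : π.H := ξ - p with hq
  have hpK : p ∈ K := Submodule.starProjection_apply_mem K ξ
  have hqK : q ∈ Kᗮ := K.sub_starProjection_mem_orthogonal ξ
  have hpq : ξ = p + q := by rw [hq]; abel
  by_cases hp0 : p = 0
  · left
    have : Kᗮ = ⊤ := htop _ (Submodule.isClosed_orthogonal K) hinv' (by
      rw [hpq, hp0, zero_add]; exact hqK)
    rw [Submodule.eq_bot_iff]
    intro x hx
    have h := (this ▸ Submodule.mem_top : x ∈ Kᗮ) x hx
    exact inner_self_eq_zero.1 h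
  by_cases hq0 : q = 0
  · right
    exact htop K hK hinv (by rw [hpq, hq0, add_zero]; exact hpK)
  exfalso
  have hcross : ∀ g, inner ℂ q (π.op g p) = 0 := fun g => by
    rw [← inner_conj_symm, hqK _ (hinv g p hpK), map_zero]
  have hcross' : ∀ g, inner ℂ p (π.op g q) = 0 := fun g => hinv' g q hqK p hpK
  have hsum : π.coeff ξ = π.coeff p + π.coeff q := by
    funext g
    have : inner ℂ (p + q) (π.op g (p + q)) = π.coeff p g + π.coeff q g := by
      simp only [map_add, inner_add_left, inner_add_right, hcross, hcross', UnitaryRep.coeff]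
      ring
    rw [← hpq] at this
    exact this
  have hnp : 0 < ‖p‖ ^ 2 := by positivity
  have hnq : 0 < ‖q‖ ^ 2 := by positivity
  have hnorm : ‖p‖ ^ 2 + ‖q‖ ^ 2 = 1 := by
    have h := congrFun hsum 1
    rw [Pi.add_apply, hone, hone, hone] at h
    rw [← hξ]
    exact_mod_cast h.symm
  have hmem : ∀ ζ : π.H, 0 < ‖ζ‖ ^ 2 → (‖ζ‖ ^ 2)⁻¹ • π.coeff ζ ∈ normalizedPositiveType G := by
    intro ζ hζ
    refine ⟨(isPositiveType_coeff π.hom ζ).smul (by positivity), ?_⟩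
    rw [Pi.smul_apply, hone, Complex.real_smul, ← Complex.ofReal_pow, ← Complex.ofReal_mul,
      inv_mul_cancel₀ hζ.ne', Complex.ofReal_one]
  -- extremality forces the normalized coefficients at `p` and `ξ` to agree
  have hseg : π.coeff ξ ∈ openSegment ℝ ((‖p‖ ^ 2)⁻¹ • π.coeff p) ((‖q‖ ^ 2)⁻¹ • π.coeff q) := by
    refine ⟨‖p‖ ^ 2, ‖q‖ ^ 2, hnp, hnq, hnorm, ?_⟩
    rw [smul_smul, smul_smul, mul_inv_cancel₀ hnp.ne', mul_inv_cancel₀ hnq.ne', one_smul, one_smul,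
      hsum]
  have hpe := hext (hmem p hnp) (hmem q hnq) hseg
  -- hence `p` is a multiple of the cyclic vector
  have hpξ : p = ((‖p‖ ^ 2 : ℝ) : ℂ) • ξ := by
    have hco : ∀ g, inner ℂ ξ (π.op g p) = ((‖p‖ ^ 2 : ℝ) : ℂ) * inner ℂ ξ (π.op g ξ) := by
      intro g
      have h := congrFun hpe g
      rw [Pi.smul_apply, Complex.real_smul] at h
      have h2 : inner ℂ ξ (π.op g ξ) = (((‖p‖ ^ 2)⁻¹ : ℝ) : ℂ) * inner ℂ p (π.op g p) := h.symm
      rw [h2, ← mul_assoc, ← Complex.ofReal_mul, mul_inv_cancel₀ hnp.ne', Complex.ofReal_one,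
        one_mul]
      conv_lhs => rw [hpq, inner_add_left, hcross, add_zero]
    rw [← sub_eq_zero]
    have hd := Submodule.dense_iff_topologicalClosure_eq_top.2 hcyc
    have hle : (Submodule.span ℂ (Set.range fun g => π.op g ξ)) ≤
        (ℂ ∙ (p - ((‖p‖ ^ 2 : ℝ) : ℂ) • ξ))ᗮ := by
      refine Submodule.span_le.2 ?_
      rintro _ ⟨g, rfl⟩
      rw [SetLike.mem_coe, Submodule.mem_orthogonal_singleton_iff_inner_left]
      have h := unitaryHom_inner_left π.hom g ξ (p - ((‖p‖ ^ 2 : ℝ) : ℂ) • ξ)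
      refine h.trans ?_
      rw [map_sub, map_smul, inner_sub_right, inner_smul_right]
      exact sub_eq_zero.2 (hco g⁻¹)
    have htop' : (ℂ ∙ (p - ((‖p‖ ^ 2 : ℝ) : ℂ) • ξ))ᗮ = ⊤ := by
      rw [eq_top_iff, ← hcyc]
      exact Submodule.topologicalClosure_minimal _ hle (Submodule.isClosed_orthogonal _)
    have h := (htop' ▸ Submodule.mem_top : (p - ((‖p‖ ^ 2 : ℝ) : ℂ) • ξ) ∈ _)
    exact inner_self_eq_zero.1 (Submodule.mem_orthogonal_singleton_iff_inner_right.1 h)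
  have hqp : inner ℂ q p = 0 := by
    rw [← inner_conj_symm, hqK _ hpK, map_zero]
  have hξq : inner ℂ q ξ = 0 := by
    rw [hpξ, inner_smul_right] at hqp
    exact (mul_eq_zero.1 hqp).resolve_left (by exact_mod_cast hnp.ne')
  rw [hpq, inner_add_right, hqp, zero_add] at hξq
  exact hq0 (inner_self_eq_zero.1 hξq)

end PositiveType

/-! ### Cones of functions of positive type -/

/-- A continuous additive map that sends generators into a submonoid sends the closed submonoid
that they generate into the closure. -/
lemma AddSubmonoid.map_mem_topologicalClosure {M M' : Type*} [TopologicalSpace M] [AddCommMonoid M]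
    [ContinuousAdd M] [TopologicalSpace M'] [AddCommMonoid M'] [ContinuousAdd M'] {S : Set M}
    {T : AddSubmonoid M'} (f : M →+ M') (hf : Continuous f) (hS : ∀ x ∈ S, f x ∈ T) {x : M}
    (hx : x ∈ (AddSubmonoid.closure S).topologicalClosure) : f x ∈ T.topologicalClosure :=
  map_mem_closure hf hx fun _ hy => (AddSubmonoid.closure_le.2 hS :
    AddSubmonoid.closure S ≤ T.comap f) hy

section Cone

variable {G : Type u} [Group G]

/-- The limits, in the topology of pointwise convergence, of finite sums of coefficients of
representations with the property `R`. -/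
def coeffCone (R : UnitaryRep G → Prop) : AddSubmonoid (G → ℂ) :=
  (AddSubmonoid.closure
    {φ | ∃ (π : UnitaryRep G) (ξ : π.H), R π ∧ π.coeff ξ = φ}).topologicalClosure

lemma coeff_mem_coeffCone {R : UnitaryRep G → Prop} {π : UnitaryRep G} (h : R π) (ξ : π.H) :
    π.coeff ξ ∈ coeffCone R :=
  AddSubmonoid.le_topologicalClosure _ (AddSubmonoid.subset_closure ⟨π, ξ, h, rfl⟩)

lemma UnitaryRep.coeff_smul (π : UnitaryRep G) (c : ℝ) (ξ : π.H) :
    π.coeff (((c : ℂ)) • ξ) = (c ^ 2) • π.coeff ξ := by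
  funext g
  simp only [UnitaryRep.coeff, map_smul, inner_smul_left, inner_smul_right, Pi.smul_apply,
    Complex.real_smul, Complex.conj_ofReal]
  push_cast
  ring

lemma smul_mem_coeffCone {R : UnitaryRep G → Prop} {φ : G → ℂ} (hφ : φ ∈ coeffCone R) {r : ℝ}
    (hr : 0 ≤ r) : r • φ ∈ coeffCone R := by
  refine AddSubmonoid.map_mem_topologicalClosure (DistribSMul.toAddMonoidHom (G → ℂ) r)
    (continuous_const_smul r) ?_ hφ
  rintro _ ⟨π, ξ, h, rfl⟩
  refine AddSubmonoid.subset_closure ⟨π, ((√r : ℝ) : ℂ) • ξ, h, ?_⟩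
  rw [UnitaryRep.coeff_smul, Real.sq_sqrt hr]; rfl

/-- By the Krein–Milman theorem, a closed cone of functions on a group that contains the
coefficients of all irreducible representations contains all functions of positive type. -/
theorem IsPositiveType.mem_coeffCone {R : UnitaryRep G → Prop}
    (hR : ∀ π : UnitaryRep G, π.IsIrreducible → ∀ ξ : π.H, π.coeff ξ ∈ coeffCone R)
    {φ : G → ℂ} (hφ : IsPositiveType φ) : φ ∈ coeffCone R := by
  have hstate : normalizedPositiveType G ⊆ coeffCone R := by
    rw [← closure_convexHull_extremePoints isCompact_normalizedPositiveType
      convex_normalizedPositiveType]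
    refine closure_minimal (convexHull_min ?_ ?_) (AddSubmonoid.isClosed_topologicalClosure _)
    · intro ψ hψ
      obtain ⟨π, ξ, hπ, rfl⟩ := exists_irreducible_of_mem_extremePoints hψ
      exact hR π hπ ξ
    · intro ψ hψ χ hχ a b ha hb _
      exact add_mem (smul_mem_coeffCone hψ ha) (smul_mem_coeffCone hχ hb)
  have hle := hφ.norm_apply_le
  by_cases h0 : (φ 1).re = 0
  · have : φ = 0 := by
      funext g
      have := hle g
      rw [h0] at this
      exact norm_le_zero_iff.1 this
    rw [this]
    exact zero_mem _
  · have hpos : 0 < (φ 1).re := lt_of_le_of_ne ((norm_nonneg _).trans (hle 1)) (Ne.symm h0)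
    have him : φ 1 = ((φ 1).re : ℂ) := by
      have := hφ.1 1
      rw [inv_one] at this
      exact (Complex.conj_eq_iff_re.1 this.symm).symm
    have hmem : ((φ 1).re)⁻¹ • φ ∈ normalizedPositiveType G := by
      refine ⟨hφ.smul (inv_nonneg.2 hpos.le), ?_⟩
      rw [Pi.smul_apply, him, Complex.real_smul, Complex.ofReal_re, ← Complex.ofReal_mul,
        inv_mul_cancel₀ hpos.ne', Complex.ofReal_one]
    have := smul_mem_coeffCone (hstate hmem) hpos.le
    rwa [smul_smul, mul_inv_cancel₀ hpos.ne', one_smul] at this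

end Cone

/-! ### Matrix coefficients at families of vectors -/

section MatrixCone

variable {G : Type u} [Group G] {X : Type v}

/-- The matrix coefficients `⟨ξ_x, U(g) ξ_y⟩` of a unitary representation at a family of vectors. -/
def matrixCoeff {H : Type w} [NormedAddCommGroup H] [InnerProductSpace ℂ H] [CompleteSpace H]
    (U : G →* unitary (H →L[ℂ] H)) (ξ : X → H) : X → X → G → ℂ :=
  fun x y g => inner ℂ (ξ x) ((U g : H →L[ℂ] H) (ξ y))

variable (X) in
/-- The finite sums of matrix coefficients, at families of vectors indexed by `X`, of
representations with the property `R`. -/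
def matrixSums (R : UnitaryRep G → Prop) : AddSubmonoid (X → X → G → ℂ) :=
  AddSubmonoid.closure {F | ∃ (π : UnitaryRep G) (η : X → π.H), R π ∧ matrixCoeff π.hom η = F}

/-- The map on functions that takes the coefficient at a vector `ζ` to the matrix coefficients at
the vectors `∑ s, b x s • U(s) ζ`. -/
def matrixTransform (b : X → G →₀ ℂ) : (G → ℂ) →+ (X → X → G → ℂ) where
  toFun φ x y g := (b x).sum fun s a => (b y).sum fun t c => star a * c * φ (s⁻¹ * g * t)
  map_zero' := by funext x y g; simp
  map_add' φ ψ := by funext x y g; simp [mul_add, Finsupp.sum_add]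

lemma continuous_matrixTransform (b : X → G →₀ ℂ) : Continuous (matrixTransform b) := by
  refine continuous_pi fun x => continuous_pi fun y => continuous_pi fun g => ?_
  simp only [matrixTransform, AddMonoidHom.coe_mk, ZeroHom.coe_mk, Finsupp.sum]
  fun_prop

variable {H : Type w} [NormedAddCommGroup H] [InnerProductSpace ℂ H] [CompleteSpace H]

lemma matrixTransform_coeff (U : G →* unitary (H →L[ℂ] H)) (ζ : H) (b : X → G →₀ ℂ) :
    matrixTransform b (fun g => inner ℂ ζ ((U g : H →L[ℂ] H) ζ)) =
      matrixCoeff U fun x => (b x).sum fun s a => a • (U s : H →L[ℂ] H) ζ := by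
  funext x y g
  simp only [matrixTransform, AddMonoidHom.coe_mk, ZeroHom.coe_mk, matrixCoeff, Finsupp.sum,
    sum_inner]
  refine Finset.sum_congr rfl fun s _ => ?_
  rw [map_sum, inner_sum]
  refine Finset.sum_congr rfl fun t _ => ?_
  rw [map_smul, inner_smul_left, inner_smul_right, ← unitaryHom_mul_apply, unitaryHom_inner_mul,
    starRingEnd_apply, ← mul_assoc, ← mul_assoc]

lemma continuous_matrixCoeff (U : G →* unitary (H →L[ℂ] H)) :
    Continuous (matrixCoeff U : (X → H) → X → X → G → ℂ) := by
  refine continuous_pi fun x => continuous_pi fun y => continuous_pi fun g => ?_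
  unfold matrixCoeff
  fun_prop

/-- If all functions of positive type are limits of sums of coefficients of representations with
the property `R`, then the same holds for matrix coefficients at families of vectors in a cyclic
subspace: up to an approximation, these are translates of the coefficient at the cyclic vector. -/
lemma matrixCoeff_mem_of_cyclic {R : UnitaryRep G → Prop}
    (hR : ∀ φ : G → ℂ, IsPositiveType φ → φ ∈ coeffCone R) (U : G →* unitary (H →L[ℂ] H)) (ζ : H)
    {ξ : X → H}
    (hξ : ∀ x, ξ x ∈
      (Submodule.span ℂ (Set.range fun g => (U g : H →L[ℂ] H) ζ)).topologicalClosure) :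
    matrixCoeff U ξ ∈ (matrixSums X R).topologicalClosure := by
  have hmem : ξ ∈ closure (Set.univ.pi fun _ : X =>
      (Submodule.span ℂ (Set.range fun g => (U g : H →L[ℂ] H) ζ) : Set H)) := by
    rw [closure_pi_set]
    exact fun x _ => hξ x
  refine closure_minimal (t := {ξ : X → H | matrixCoeff U ξ ∈ (matrixSums X R).topologicalClosure})
    ?_ ((AddSubmonoid.isClosed_topologicalClosure _).preimage (continuous_matrixCoeff U)) hmem
  intro ω hω
  have h : ∀ x, ∃ b : G →₀ ℂ, (b.sum fun s a => a • (U s : H →L[ℂ] H) ζ) = ω x := fun x =>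
    Finsupp.mem_span_range_iff_exists_finsupp.1 (hω x trivial)
  choose b hb using h
  have hω' : ω = fun x => (b x).sum fun s a => a • (U s : H →L[ℂ] H) ζ :=
    funext fun x => (hb x).symm
  rw [Set.mem_ofPred_eq, hω', ← matrixTransform_coeff]
  refine AddSubmonoid.map_mem_topologicalClosure _ (continuous_matrixTransform b) ?_
    (hR _ (isPositiveType_coeff U ζ))
  rintro _ ⟨π, η, hπ, rfl⟩
  exact AddSubmonoid.subset_closure ⟨π, _, hπ, (matrixTransform_coeff π.hom η b).symm⟩

/-- The passage from coefficients to matrix coefficients for arbitrary finite families of vectors: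
the cyclic subspace that one of the vectors generates can be split off, and the components
of the family in its complement have one nonzero member less. -/
theorem matrixCoeff_mem [Finite X] {R : UnitaryRep G → Prop}
    (hR : ∀ φ : G → ℂ, IsPositiveType φ → φ ∈ coeffCone R) (U : G →* unitary (H →L[ℂ] H))
    (ξ : X → H) : matrixCoeff U ξ ∈ (matrixSums X R).topologicalClosure := by
  classical
  have := Fintype.ofFinite X
  suffices h : ∀ (s : Finset X) (ξ : X → H), (∀ x, x ∉ s → ξ x = 0) →
      matrixCoeff U ξ ∈ (matrixSums X R).topologicalClosure from
    h Finset.univ ξ fun x hx => absurd (Finset.mem_univ x) hx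
  intro s
  induction s using Finset.induction_on with
  | empty =>
    intro ξ hξ
    have : matrixCoeff U ξ = 0 := by
      funext x y g
      simp [matrixCoeff, hξ x (Finset.notMem_empty x)]
    rw [this]
    exact zero_mem _
  | insert x₀ s _ ih =>
    intro ξ hξ
    let K := (Submodule.span ℂ (Set.range fun g => (U g : H →L[ℂ] H) (ξ x₀))).topologicalClosure
    have hKc : IsClosed (K : Set H) := Submodule.isClosed_topologicalClosure _
    have : CompleteSpace K := hKc.completeSpace_coe
    have hK : ∀ g, ∀ v ∈ K, (U g : H →L[ℂ] H) v ∈ K := by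
      intro g
      refine Submodule.topologicalClosure_minimal _ (t := K.comap (U g : H →L[ℂ] H).toLinearMap)
        (Submodule.span_le.2 ?_) (hKc.preimage (U g : H →L[ℂ] H).continuous)
      rintro _ ⟨t, rfl⟩
      refine Submodule.le_topologicalClosure _ (Submodule.subset_span ⟨g * t, ?_⟩)
      exact unitaryHom_mul_apply U g t _
    have hx₀ : ξ x₀ ∈ K :=
      Submodule.le_topologicalClosure _ (Submodule.subset_span ⟨1, unitaryHom_one_apply U _⟩)
    let p : X → H := fun x => K.starProjection (ξ x)
    let q : X → H := fun x => ξ x - p x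
    have hp : ∀ x, p x ∈ K := fun x => Submodule.starProjection_apply_mem K _
    have hq : ∀ x, q x ∈ Kᗮ := fun x => K.sub_starProjection_mem_orthogonal _
    have hsum : matrixCoeff U ξ = matrixCoeff U p + matrixCoeff U q := by
      funext x y g
      have h1 : inner ℂ (q x) ((U g : H →L[ℂ] H) (p y)) = 0 := by
        rw [← inner_conj_symm, hq x _ (hK g _ (hp y)), map_zero]
      have h2 : inner ℂ (p x) ((U g : H →L[ℂ] H) (q y)) = 0 := by
        have h := unitaryHom_inner_left U g⁻¹ (p x) (q y)
        rw [inv_inv] at h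
        rw [← h]
        exact hq y _ (hK _ _ (hp x))
      have h3 : ∀ x, ξ x = p x + q x := fun x => by simp only [q]; abel
      simp only [matrixCoeff, Pi.add_apply, h3, map_add, inner_add_left, inner_add_right, h1, h2]
      ring
    rw [hsum]
    refine add_mem (matrixCoeff_mem_of_cyclic hR U (ξ x₀) hp) (ih q fun x hx => ?_)
    by_cases hxx : x = x₀
    · subst hxx
      simp only [q, p, K.starProjection_eq_self_iff.2 hx₀, sub_self]
    · have : ξ x = 0 := hξ x (by simp [hx, hxx])
      simp [q, p, this]

end MatrixCone

/-! ### Representations of crossed products -/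

namespace CrossedProduct

section General

variable {A G : Type u} [CStarAlgebra A] [Group G] {α : G →* (A ≃⋆ₐ[ℂ] A)}

lemma ambientGrp_mul (g h : G) : ambientGrp α (g * h) = ambientGrp α g * ambientGrp α h := by
  ext r : 2
  change ((r.grp (g * h) : r.H →L[ℂ] r.H)) = (r.grp g : r.H →L[ℂ] r.H) * (r.grp h : r.H →L[ℂ] r.H)
  rw [map_mul]; rfl

lemma ambientGrp_one : ambientGrp α 1 = 1 := by
  ext r : 2
  change ((r.grp 1 : r.H →L[ℂ] r.H)) = 1
  rw [map_one]; rfl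

lemma star_ambientGrp (g : G) : star (ambientGrp α g) = ambientGrp α g⁻¹ := by
  ext r : 2
  change star ((r.grp g : r.H →L[ℂ] r.H)) = (r.grp g⁻¹ : r.H →L[ℂ] r.H)
  rw [map_inv]; rfl

lemma ambientAlg_mul (a b : A) : ambientAlg α (a * b) = ambientAlg α a * ambientAlg α b := by
  ext r : 2
  exact map_mul r.alg a b

lemma ambientAlg_one : ambientAlg α 1 = 1 := by
  ext r : 2
  exact map_one r.alg

lemma star_ambientAlg (a : A) : star (ambientAlg α a) = ambientAlg α (star a) := by
  ext r : 2
  exact (map_star r.alg a).symm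

lemma ambientGrp_mul_ambientAlg (g : G) (a : A) :
    ambientGrp α g * ambientAlg α a = ambientAlg α (α g a) * ambientGrp α g := by
  ext r : 2
  change (r.grp g : r.H →L[ℂ] r.H) * r.alg a = r.alg (α g a) * (r.grp g : r.H →L[ℂ] r.H)
  rw [← r.covariant, mul_assoc, Unitary.star_mul_self_of_mem (r.grp g).2, mul_one]

/-- The canonical homomorphism from the group to the unitaries of the crossed product. -/
def grpHom (α : G →* (A ≃⋆ₐ[ℂ] A)) : G →* unitary (CrossedProduct α) where
  toFun g := ⟨ofGrp α g, by
    rw [Unitary.mem_iff]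
    constructor <;> refine Subtype.ext ?_
    · change star (ambientGrp α g) * ambientGrp α g = 1
      rw [star_ambientGrp, ← ambientGrp_mul, inv_mul_cancel, ambientGrp_one]
    · change ambientGrp α g * star (ambientGrp α g) = 1
      rw [star_ambientGrp, ← ambientGrp_mul, mul_inv_cancel, ambientGrp_one]⟩
  map_one' := Subtype.ext (Subtype.ext ambientGrp_one)
  map_mul' g h := Subtype.ext (Subtype.ext (ambientGrp_mul g h))

/-- The canonical homomorphism from the algebra to the crossed product. -/
def algHom (α : G →* (A ≃⋆ₐ[ℂ] A)) : A →⋆ₐ[ℂ] CrossedProduct α where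
  toFun := ofAlg α
  map_one' := Subtype.ext ambientAlg_one
  map_mul' a b := Subtype.ext (ambientAlg_mul a b)
  map_zero' := Subtype.ext (by ext r : 2; exact map_zero r.alg)
  map_add' a b := Subtype.ext (by ext r : 2; exact map_add r.alg a b)
  commutes' c := Subtype.ext (by ext r : 2; exact AlgHomClass.commutes r.alg c)
  map_star' a := Subtype.ext (star_ambientAlg a).symm

lemma ofGrp_mul_ofAlg (g : G) (a : A) :
    ofGrp α g * ofAlg α a = ofAlg α (α g a) * ofGrp α g :=
  Subtype.ext (ambientGrp_mul_ambientAlg g a)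

lemma algebraicPart_le_span : Subalgebra.toSubmodule (algebraicPart α).toSubalgebra ≤
    Submodule.span ℂ {x | ∃ a g, x = ambientAlg α a * ambientGrp α g} := by
  rw [algebraicPart, StarAlgebra.adjoin_eq_span]
  refine Submodule.span_mono ?_
  let M : Submonoid (Ambient α) :=
    { carrier := {x | ∃ a g, x = ambientAlg α a * ambientGrp α g}
      one_mem' := ⟨1, 1, by rw [ambientAlg_one, ambientGrp_one, one_mul]⟩
      mul_mem' := by
        rintro _ _ ⟨a, g, rfl⟩ ⟨b, h, rfl⟩
        refine ⟨a * α g b, g * h, ?_⟩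
        rw [ambientAlg_mul, ambientGrp_mul, mul_assoc, ← mul_assoc (ambientGrp α g),
          ambientGrp_mul_ambientAlg]
        simp only [mul_assoc] }
  have halg : ∀ a, ambientAlg α a ∈ M := fun a => ⟨a, 1, by rw [ambientGrp_one, mul_one]⟩
  have hgrp : ∀ g, ambientGrp α g ∈ M := fun g => ⟨1, g, by rw [ambientAlg_one, one_mul]⟩
  refine (Submonoid.closure_le (S := M)).2 ?_
  rintro x ((⟨a, rfl⟩ | ⟨g, rfl⟩) | (⟨a, ha⟩ | ⟨g, hg⟩))
  · exact halg a
  · exact hgrp g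
  · rw [← star_star x, ← ha, star_ambientAlg]
    exact halg _
  · rw [← star_star x, ← hg, star_ambientGrp]
    exact hgrp _

/-- The products of an algebra element and a group element span a dense subspace. -/
theorem eq_top_of_isClosed (M : Submodule ℂ (CrossedProduct α))
    (hM : IsClosed (M : Set (CrossedProduct α))) (h : ∀ a g, ofAlg α a * ofGrp α g ∈ M) :
    M = ⊤ := by
  let ι : CrossedProduct α →⋆ₐ[ℂ] Ambient α := (algebraicPart α).topologicalClosure.subtype
  have hι : IsClosed ((ι : CrossedProduct α → Ambient α) '' (M : Set (CrossedProduct α))) :=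
    ((StarSubalgebra.isClosed_topologicalClosure
      (algebraicPart α)).isClosedEmbedding_subtypeVal.isClosedMap) _ hM
  have hspan : Submodule.span ℂ {x | ∃ a g, x = ambientAlg α a * ambientGrp α g} ≤
      M.map ι.toAlgHom.toLinearMap := by
    refine Submodule.span_le.2 ?_
    rintro _ ⟨a, g, rfl⟩
    exact ⟨_, h a g, rfl⟩
  rw [eq_top_iff]
  rintro x -
  have hx : x.1 ∈ closure ((algebraicPart α : Set (Ambient α))) := x.2
  obtain ⟨y, hy, hyx⟩ := closure_minimal (fun z hz => hspan (algebraicPart_le_span hz)) hι hx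
  have : y = x := Subtype.ext hyx
  exact this ▸ hy

/-- A covariant representation as a representation of the crossed product. -/
def _root_.CovariantRep.toCStarRep (r : CovariantRep α) :
    CStarRep.{u + 1, u} (CrossedProduct α) where
  H := r.H
  hom :=
    { toFun := fun x => x.1 r
      map_one' := rfl
      map_mul' := fun _ _ => rfl
      map_zero' := rfl
      map_add' := fun _ _ => rfl
      commutes' := fun _ => rfl
      map_star' := fun _ => rfl }

end General

end CrossedProduct

/-! ### Representations at the finite levels -/

section Regular

variable {K H : Type u} [NormedAddCommGroup H] [InnerProductSpace ℂ H]

/-- Multiplication by a scalar function on the Hilbert space of functions `K → H`. -/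
def diagonalOp (f : K → ℂ) : PiLp 2 (fun _ : K => H) →L[ℂ] PiLp 2 (fun _ : K => H) :=
  ((PiLp.continuousLinearEquiv 2 ℂ (fun _ : K => H)).symm : (K → H) →L[ℂ] _) ∘L
    (ContinuousLinearMap.pi fun x => f x • ContinuousLinearMap.proj x) ∘L
      ((PiLp.continuousLinearEquiv 2 ℂ (fun _ : K => H)) : _ →L[ℂ] (K → H))

lemma diagonalOp_apply (f : K → ℂ) (v : PiLp 2 (fun _ : K => H)) (x : K) :
    diagonalOp f v x = f x • v x := rfl

variable [Fintype K] [CompleteSpace H]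

/-- Functions on `K` as multiplication operators. -/
def diagonalHom :
    (K → ℂ) →⋆ₐ[ℂ] (PiLp 2 (fun _ : K => H) →L[ℂ] PiLp 2 (fun _ : K => H)) where
  toFun := diagonalOp
  map_one' := by ext v x; simp [diagonalOp_apply]
  map_mul' f g := by ext v x; simp [diagonalOp_apply, mul_smul]
  map_zero' := by ext v x; simp [diagonalOp_apply]
  map_add' f g := by ext v x; simp [diagonalOp_apply, add_smul]
  commutes' c := by
    ext v x
    simp [diagonalOp_apply, Algebra.algebraMap_eq_smul_one]
  map_star' f := by
    rw [ContinuousLinearMap.star_eq_adjoint, ContinuousLinearMap.eq_adjoint_iff]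
    intro v w
    simp [PiLp.inner_apply, diagonalOp_apply, inner_smul_left, inner_smul_right]

variable [Group K]

/-- The tensor product of a unitary representation with the left regular representation, on the
Hilbert space of functions `K → H`. -/
def tensorRegular (τ : K →* unitary (H →L[ℂ] H)) :
    K →* unitary (PiLp 2 (fun _ : K => H) →L[ℂ] PiLp 2 (fun _ : K => H)) :=
  Unitary.linearIsometryEquiv.symm.toMonoidHom.comp
    { toFun := fun g => (LinearIsometryEquiv.piLpCongrLeft 2 ℂ H (Equiv.mulLeft g)).trans
        (LinearIsometryEquiv.piLpCongrRight 2 fun _ => Unitary.linearIsometryEquiv (τ g))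
      map_one' := by
        ext v x
        simp [LinearIsometryEquiv.piLpCongrLeft_apply]
        rfl
      map_mul' := fun g h => by
        ext v x
        simp [LinearIsometryEquiv.piLpCongrLeft_apply]
        rfl }

lemma tensorRegular_apply (τ : K →* unitary (H →L[ℂ] H)) (g : K) (v : PiLp 2 (fun _ : K => H))
    (x : K) : (tensorRegular τ g : _ →L[ℂ] PiLp 2 (fun _ : K => H)) v x =
      (τ g : H →L[ℂ] H) (v (g⁻¹ * x)) := by
  rfl

/-- The covariant representation of the functions on a finite group `K` that belongs to a unitary
representation of `K`: on the space of functions `K → H`, functions act by multiplication and the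
group by the tensor product with the left regular representation. -/
def regularCovariantRep [Nontrivial H] (τ : K →* unitary (H →L[ℂ] H)) :
    CovariantRep (A := K → ℂ) (translation K K) where
  H := PiLp 2 (fun _ : K => H)
  nontrivial := by
    obtain ⟨h, hh⟩ := exists_ne (0 : H)
    refine ⟨WithLp.toLp 2 fun _ => h, 0, fun e => hh ?_⟩
    exact congrArg (fun v : PiLp 2 (fun _ : K => H) => v 1) e
  alg := diagonalHom
  grp := tensorRegular τ
  covariant g f := by
    have h : (tensorRegular τ g : _ →L[ℂ] PiLp 2 (fun _ : K => H)) * diagonalOp f =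
        diagonalOp (translation K K g f) *
          (tensorRegular τ g : _ →L[ℂ] PiLp 2 (fun _ : K => H)) := by
      ext v x
      change (tensorRegular τ g : _ →L[ℂ] PiLp 2 (fun _ : K => H)) (diagonalOp f v) x =
        diagonalOp (translation K K g f) ((tensorRegular τ g : _ →L[ℂ] PiLp 2 (fun _ : K => H)) v) x
      rw [tensorRegular_apply, diagonalOp_apply, diagonalOp_apply, tensorRegular_apply, map_smul]
      rfl
    change (tensorRegular τ g : _ →L[ℂ] PiLp 2 (fun _ : K => H)) * diagonalOp f * _ =
      diagonalOp (translation K K g f)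
    rw [h, mul_assoc, Unitary.mul_star_self_of_mem (tensorRegular τ g).2, mul_one]

end Regular

namespace FDFamily

variable {Γ : Type u} [Group Γ] (N : ℕ → Subgroup Γ) [∀ i, (N i).Normal] [∀ i, (N i).FiniteIndex]

/-- The representations of the crossed product at level `i` that factor through a later finite
level. -/
def finiteLevelReps (hN : Antitone N) (i : ℕ) : Set (CStarRep.{u + 1, u} (FullLevel N i)) :=
  {τ | ∃ (j : ℕ) (hij : i ≤ j) (τ' : CStarRep.{u + 1, u} (FiniteLevel N j)),
    τ = τ'.comp (natMap N hN hij)}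

/-- Matrix coefficients of a representation of `Γ / N_j` are realized at the finite level `j`: in
the representation on functions `Γ / N_j → H`, one takes the normalized pullback of the family of
vectors along `Γ / N_j → Γ / N_i`. -/
lemma exists_finiteLevelRep (hN : Antitone N) {i j : ℕ} (hij : i ≤ j) (π : UnitaryRep Γ)
    [Nontrivial π.H] (hπ : N j ≤ π.hom.ker) (η : Γ ⧸ N i → π.H) :
    ∃ τ ∈ finiteLevelReps N hN i, ∃ v : τ.H, ∀ (f : Alg N i) (g : Γ),
      τ.coeff v (CrossedProduct.ofAlg _ f * CrossedProduct.ofGrp _ g) =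
        ∑ x, f x * matrixCoeff π.hom η x (g⁻¹ • x) g := by
  classical
  let τ₀ : Γ ⧸ N j →* unitary (π.H →L[ℂ] π.H) := QuotientGroup.lift (N j) π.hom hπ
  let r := regularCovariantRep τ₀
  let p := proj N hN hij
  have hp : Function.Surjective p := fun x => by
    induction x using QuotientGroup.induction_on with
    | H x => exact ⟨QuotientGroup.mk x, rfl⟩
  let m : ℕ := (Finset.univ.filter fun y => p y = 1).card
  have hcard : ∀ x, (Finset.univ.filter fun y => p y = x).card = m := fun x =>
    MonoidHom.card_fiber_eq_of_mem_range p (hp x) (hp 1)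
  have hm : (m : ℂ) ≠ 0 := by
    rw [Nat.cast_ne_zero, ← Nat.pos_iff_ne_zero, Finset.card_pos]
    exact ⟨1, by simp⟩
  -- every point of `Γ / N_i` has `m` preimages, so the pullback of `η` is scaled by `1 / √m`
  let c : ℂ := ((√(m : ℝ))⁻¹ : ℝ)
  have hc : star c * c = (m : ℂ)⁻¹ := by
    simp only [c, Complex.star_def, Complex.conj_ofReal]
    rw [← Complex.ofReal_mul, ← mul_inv, Real.mul_self_sqrt (Nat.cast_nonneg m)]
    simp
  refine ⟨r.toCStarRep.comp (natMap N hN hij), ⟨j, hij, _, rfl⟩,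
    (WithLp.toLp 2 fun y => c • η (p y) : PiLp 2 fun _ : Γ ⧸ N j => π.H), fun f g => ?_⟩
  let v : PiLp 2 fun _ : Γ ⧸ N j => π.H := WithLp.toLp 2 fun y => c • η (p y)
  change inner ℂ v (diagonalOp (rho N hN hij f)
    ((tensorRegular τ₀ (QuotientGroup.mk' (N j) g) : _ →L[ℂ] PiLp 2 fun _ : Γ ⧸ N j => π.H) v)) = _
  let F : Γ ⧸ N i → ℂ := fun x => f x * matrixCoeff π.hom η x (g⁻¹ • x) g
  have hterm : ∀ y : Γ ⧸ N j, inner ℂ (v y) (diagonalOp (rho N hN hij f)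
      ((tensorRegular τ₀ (QuotientGroup.mk' (N j) g) :
        _ →L[ℂ] PiLp 2 fun _ : Γ ⧸ N j => π.H) v) y) =
      (m : ℂ)⁻¹ * F (p y) := by
    intro y
    rw [diagonalOp_apply, tensorRegular_apply]
    change inner ℂ (c • η (p y)) (f (p y) • (π.hom g : π.H →L[ℂ] π.H)
      (c • η (p ((QuotientGroup.mk' (N j) g)⁻¹ * y)))) = _
    have hpy : p ((QuotientGroup.mk' (N j) g)⁻¹ * y) = g⁻¹ • p y := by
      rw [map_mul]; induction y using QuotientGroup.induction_on with
      | H y => rfl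
    rw [hpy, map_smul, inner_smul_left, inner_smul_right, inner_smul_right, ← hc,
      starRingEnd_apply]
    simp only [F, matrixCoeff]
    ring
  rw [PiLp.inner_apply, Finset.sum_congr rfl fun y _ => hterm y, ← Finset.mul_sum,
    ← Finset.sum_fiberwise (g := p)]
  have hfib : ∀ x, ∑ y with p y = x, F (p y) = m * F x := by
    intro x
    rw [Finset.sum_congr rfl (g := fun _ => F x), Finset.sum_const, hcard, nsmul_eq_mul]
    intro y hy
    rw [(Finset.mem_filter.1 hy).2]
  rw [Finset.sum_congr rfl fun x _ => hfib x, ← Finset.mul_sum, ← mul_assoc, inv_mul_cancel₀ hm,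
    one_mul]

end FDFamily

namespace CrossedProduct

variable {Γ X : Type u} [Group Γ] [Fintype X] [MulAction Γ X]

/-- A positive functional on the crossed product by a finite `Γ`-set is determined by matrix
coefficients of the group at the vectors into which the point projections decompose the given
vector. -/
lemma coeff_ofAlg_mul_ofGrp (σ : CStarRep.{u + 1, w} (CrossedProduct (translation Γ X))) (ξ : σ.H) :
    ∃ (U : Γ →* unitary (σ.H →L[ℂ] σ.H)) (η : X → σ.H), ∀ (f : X → ℂ) (g : Γ),
      σ.coeff ξ (ofAlg _ f * ofGrp _ g) = ∑ x, f x * matrixCoeff U η x (g⁻¹ • x) g := by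
  classical
  -- the point projections
  let e : X → (X → ℂ) := fun x => Pi.single x 1
  let M : (X → ℂ) →⋆ₐ[ℂ] (σ.H →L[ℂ] σ.H) := σ.hom.comp (algHom (translation Γ X))
  let U : Γ →* unitary (σ.H →L[ℂ] σ.H) := 
    { toFun := fun g => ⟨σ.hom (ofGrp _ g), Unitary.map_mem σ.hom (grpHom (translation Γ X) g).2⟩
      map_one' := Subtype.ext <| by
        change σ.hom (grpHom (translation Γ X) 1 : unitary _).1 = 1
        rw [map_one]; exact map_one σ.hom
      map_mul' := fun g h => Subtype.ext <| by
        change σ.hom (grpHom (translation Γ X) (g * h) : unitary _).1 = _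
        rw [map_mul]; exact map_mul σ.hom _ _ }
  have hUM : ∀ g f, (U g : σ.H →L[ℂ] σ.H) * M f =
      M (translation Γ X g f) * (U g : σ.H →L[ℂ] σ.H) := by
    intro g f
    have h := congrArg σ.hom (ofGrp_mul_ofAlg (α := translation Γ X) g f)
    rw [map_mul, map_mul] at h
    exact h
  have hstar : ∀ x, star (e x) = e x := fun x => by
    funext y
    by_cases h : y = x <;> simp [e, h]
  have hidem : ∀ x, e x * e x = e x := fun x => by
    funext y
    by_cases h : y = x <;> simp [e, h]
  have htrans : ∀ (g : Γ) x, translation Γ X g (e (g⁻¹ • x)) = e x := fun g x => by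
    funext y
    change e (g⁻¹ • x) (g⁻¹ • y) = e x y
    simp [e, Pi.single_apply]
  refine ⟨U, fun x => M (e x) ξ, fun f g => ?_⟩
  have hf : f = ∑ x, f x • e x := by
    funext y
    simp [e, Finset.sum_apply, Pi.single_apply]
  have hcoeff : σ.coeff ξ (ofAlg _ f * ofGrp _ g) = inner ℂ ξ (M f ((U g : σ.H →L[ℂ] σ.H) ξ)) := by
    rw [CStarRep.coeff, map_mul]; rfl
  have hterm : ∀ x, inner ℂ ξ (M (e x) ((U g : σ.H →L[ℂ] σ.H) ξ)) =
      matrixCoeff U (fun x => M (e x) ξ) x (g⁻¹ • x) g := by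
    intro x
    have h1 := congrArg (fun T : σ.H →L[ℂ] σ.H => T ξ) (hUM g (e (g⁻¹ • x)))
    rw [htrans] at h1
    have h2 : (U g : σ.H →L[ℂ] σ.H) (M (e (g⁻¹ • x)) ξ) = M (e x) ((U g : σ.H →L[ℂ] σ.H) ξ) := h1
    have h3 : ContinuousLinearMap.adjoint (M (e x)) = M (e x) := by
      rw [← ContinuousLinearMap.star_eq_adjoint, ← map_star, hstar]
    rw [matrixCoeff, h2]
    conv_rhs => rw [← h3]
    rw [← ContinuousLinearMap.adjoint_inner_right, h3, h3]
    change _ = inner ℂ ξ ((M (e x) * M (e x)) _)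
    rw [← map_mul, hidem]
  rw [hcoeff]
  conv_lhs => rw [hf]
  simp only [map_sum, map_smul, FunLike.coe_sum, FunLike.coe_smul,
    Finset.sum_apply, Pi.smul_apply, inner_sum, inner_smul_right, hterm]

end CrossedProduct

/-! ### Weak containment -/

namespace CStarRep

variable {A : Type v} [CStarAlgebra A]

/-- The finite sums of positive functionals associated to representations in `S`. -/
def functionalSums (S : Set (CStarRep.{v, u} A)) : AddSubmonoid (A → ℂ) :=
  AddSubmonoid.closure {ψ | ∃ τ ∈ S, ∃ η : τ.H, τ.coeff η = ψ}

lemma coeff_one (σ : CStarRep.{v, w} A) (ξ : σ.H) : σ.coeff ξ 1 = ((‖ξ‖ ^ 2 : ℝ) : ℂ) := by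
  rw [coeff, map_one]
  change Inner.inner ℂ ξ ξ = _
  rw [inner_self_eq_norm_sq_to_K]
  push_cast
  rfl

lemma coeff_add (σ : CStarRep.{v, w} A) (ξ : σ.H) (a b : A) :
    σ.coeff ξ (a + b) = σ.coeff ξ a + σ.coeff ξ b := by
  rw [coeff, map_add, add_apply, _root_.inner_add_right]; rfl

lemma coeff_smul (σ : CStarRep.{v, w} A) (ξ : σ.H) (c : ℂ) (a : A) :
    σ.coeff ξ (c • a) = c * σ.coeff ξ a := by
  rw [coeff, map_smul, smul_apply, _root_.inner_smul_right]; rfl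

lemma norm_coeff_le (σ : CStarRep.{v, w} A) (ξ : σ.H) (a : A) :
    ‖σ.coeff ξ a‖ ≤ ‖a‖ * ‖ξ‖ ^ 2 := by
  calc ‖σ.coeff ξ a‖ ≤ ‖ξ‖ * (‖σ.hom a‖ * ‖ξ‖) :=
        (norm_inner_le_norm _ _).trans (by gcongr; exact (σ.hom a).le_opNorm ξ)
    _ ≤ ‖ξ‖ * (‖a‖ * ‖ξ‖) := by gcongr; exact NonUnitalStarAlgHom.norm_apply_le σ.hom a
    _ = ‖a‖ * ‖ξ‖ ^ 2 := by ring

/-- A sum of positive functionals is linear and attains its norm at the identity. -/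
lemma functionalSums_bound {S : Set (CStarRep.{v, u} A)} {ψ : A → ℂ} (hψ : ψ ∈ functionalSums S) :
    (∀ a b, ψ (a + b) = ψ a + ψ b) ∧ (∀ (c : ℂ) a, ψ (c • a) = c * ψ a) ∧
      ∀ a, ‖ψ a‖ ≤ ‖a‖ * (ψ 1).re := by
  induction hψ using AddSubmonoid.closure_induction with
  | mem ψ h =>
    obtain ⟨τ, -, η, rfl⟩ := h
    refine ⟨τ.coeff_add η, τ.coeff_smul η, fun a => ?_⟩
    rw [coeff_one, Complex.ofReal_re]
    exact τ.norm_coeff_le η a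
  | zero => simp
  | add ψ χ _ _ h1 h2 =>
    refine ⟨fun a b => ?_, fun c a => ?_, fun a => ?_⟩
    · simp only [Pi.add_apply, h1.1, h2.1]; ring
    · simp only [Pi.add_apply, h1.2.1, h2.2.1]; ring
    · simp only [Pi.add_apply, Complex.add_re, mul_add]
      exact (norm_add_le _ _).trans (add_le_add (h1.2.2 a) (h2.2.2 a))

/-- Sums of positive functionals that converge at the identity and on a total subset to a
positive functional converge pointwise: they are eventually bounded. -/
lemma tendsto_of_total {S : Set (CStarRep.{v, u} A)} (σ : CStarRep.{v, w} A) (ξ : σ.H) {ι : Type*}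
    {l : Filter ι} {ψ : ι → A → ℂ} (hψ : ∀ k, ψ k ∈ functionalSums S)
    (h1 : Tendsto (fun k => ψ k 1) l (𝓝 (σ.coeff ξ 1))) (T : Set A)
    (hT : ∀ M : Submodule ℂ A, IsClosed (M : Set A) → T ⊆ M → M = ⊤)
    (h : ∀ a ∈ T, Tendsto (fun k => ψ k a) l (𝓝 (σ.coeff ξ a))) (a : A) :
    Tendsto (fun k => ψ k a) l (𝓝 (σ.coeff ξ a)) := by
  let M : Submodule ℂ A :=
    { carrier := {a | Tendsto (fun k => ψ k a) l (𝓝 (σ.coeff ξ a))}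
      add_mem' := fun {a b} ha hb => by
        simp only [Set.mem_ofPred_eq, (functionalSums_bound (hψ _)).1, coeff_add]
        exact ha.add hb
      zero_mem' := by
        have h0 : ∀ k, ψ k 0 = 0 := fun k => by
          simpa using (functionalSums_bound (hψ k)).2.1 0 0
        have h0' : σ.coeff ξ 0 = 0 := by simpa using σ.coeff_smul ξ 0 0
        simp only [Set.mem_ofPred_eq, h0, h0', tendsto_const_nhds]
      smul_mem' := fun c a ha => by
        simp only [Set.mem_ofPred_eq, (functionalSums_bound (hψ _)).2.1, coeff_smul]
        exact ha.const_mul c }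
  suffices hM : M = ⊤ from (hM ▸ Submodule.mem_top : a ∈ M)
  refine hT M ?_ h
  refine isClosed_of_closure_subset fun a ha => ?_
  change Tendsto (fun k => ψ k a) l (𝓝 (σ.coeff ξ a))
  rw [Metric.tendsto_nhds]
  intro ε hε
  set C : ℝ := ‖ξ‖ ^ 2 + 1 with hC
  have hCpos : 0 < C := by positivity
  obtain ⟨b, hb, hab⟩ := Metric.mem_closure_iff.1 ha (ε / (3 * C)) (by positivity)
  have hre : Tendsto (fun k => (ψ k 1).re) l (𝓝 (‖ξ‖ ^ 2)) := by
    have := (Complex.continuous_re.tendsto _).comp h1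
    rwa [coeff_one, Complex.ofReal_re] at this
  have hbd : ∀ᶠ k in l, (ψ k 1).re < C := hre.eventually_lt_const (by linarith)
  have hb' : ∀ᶠ k in l, dist (ψ k b) (σ.coeff ξ b) < ε / 3 :=
    Metric.tendsto_nhds.1 hb _ (by positivity)
  rw [dist_eq_norm] at hab
  have hsmall : ‖a - b‖ * C < ε / 3 := by
    calc ‖a - b‖ * C < ε / (3 * C) * C := by gcongr
      _ = ε / 3 := by field_simp
  filter_upwards [hbd, hb'] with k hk hkb
  obtain ⟨hadd, -, hle⟩ := functionalSums_bound (hψ k)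
  have e1 : ψ k a = ψ k (a - b) + ψ k b := by rw [← hadd, sub_add_cancel]
  have e2 : σ.coeff ξ a = σ.coeff ξ (a - b) + σ.coeff ξ b := by rw [← coeff_add, sub_add_cancel]
  have n1 : ‖ψ k (a - b)‖ < ε / 3 := (hle _).trans_lt
    ((mul_le_mul_of_nonneg_left hk.le (norm_nonneg _)).trans_lt hsmall)
  have n2 : ‖σ.coeff ξ (a - b)‖ < ε / 3 := (norm_coeff_le σ ξ _).trans_lt
    ((mul_le_mul_of_nonneg_left (by linarith) (norm_nonneg _)).trans_lt hsmall)
  rw [dist_eq_norm] at hkb ⊢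
  rw [e1, e2, add_sub_add_comm]
  calc ‖ψ k (a - b) - σ.coeff ξ (a - b) + (ψ k b - σ.coeff ξ b)‖
      ≤ ‖ψ k (a - b)‖ + ‖σ.coeff ξ (a - b)‖ + ‖ψ k b - σ.coeff ξ b‖ :=
        (norm_add_le _ _).trans (by gcongr; exact norm_sub_le _ _)
    _ < ε := by linarith

lemma weaklyContained_of_mem_closure {S : Set (CStarRep.{v, u} A)} (σ : CStarRep.{v, w} A)
    (h : ∀ ξ : σ.H, σ.coeff ξ ∈ closure (functionalSums S : Set (A → ℂ))) :
    σ.WeaklyContained S := by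
  intro ξ F ε hε
  have hopen : IsOpen {ψ : A → ℂ | ∀ a ∈ F, ‖σ.coeff ξ a - ψ a‖ < ε} := by
    have : {ψ : A → ℂ | ∀ a ∈ F, ‖σ.coeff ξ a - ψ a‖ < ε} =
        ⋂ a ∈ F, {ψ : A → ℂ | ‖σ.coeff ξ a - ψ a‖ < ε} := by ext; simp
    rw [this]
    exact isOpen_biInter_finset fun a _ => isOpen_lt (by fun_prop) continuous_const
  obtain ⟨ψ, hψF, hψ⟩ := mem_closure_iff.1 (h ξ) _ hopen (by simpa using fun _ _ => hε)
  obtain ⟨L, hL, rfl⟩ := AddSubmonoid.exists_list_of_mem_closure hψ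
  have hL' : ∀ k : Fin L.length, ∃ τ ∈ S, ∃ η : τ.H, τ.coeff η = L.get k :=
    fun k => hL _ (List.get_mem L k)
  choose τ hτ η hη using hL'
  refine ⟨L.length, τ, η, hτ, fun a ha => ?_⟩
  have hsum : L.sum = ∑ k, L.get k := by
    rw [← List.sum_ofFn, List.ofFn_get]
  have := hψF a ha
  rw [hsum, Finset.sum_apply] at this
  simpa only [hη] using this

lemma coeff_star_mul_self (σ : CStarRep.{v, w} A) (ξ : σ.H) (x : A) :
    σ.coeff ξ (star x * x) = ((‖σ.hom x ξ‖ ^ 2 : ℝ) : ℂ) := by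
  rw [coeff, map_mul, map_star, ContinuousLinearMap.star_eq_adjoint]
  change Inner.inner ℂ ξ (ContinuousLinearMap.adjoint (σ.hom x) (σ.hom x ξ)) = _
  rw [ContinuousLinearMap.adjoint_inner_right, inner_self_eq_norm_sq_to_K]
  push_cast
  rfl

/-- A weakly contained representation is dominated in norm. -/
lemma WeaklyContained.norm_hom_le {S : Set (CStarRep.{v, u} A)} {σ : CStarRep.{v, w} A}
    (hσ : σ.WeaklyContained S) {x : A} {C : ℝ} (hC : 0 ≤ C) (h : ∀ τ ∈ S, ‖τ.hom x‖ ≤ C) :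
    ‖σ.hom x‖ ≤ C := by
  refine ContinuousLinearMap.opNorm_le_bound _ hC fun ξ => ?_
  have hsq : ‖σ.hom x ξ‖ ^ 2 ≤ C ^ 2 * ‖ξ‖ ^ 2 := by
    refine le_of_forall_pos_le_add fun δ hδ => ?_
    classical
    set ε := δ / (C ^ 2 + 1) with hε
    have hεpos : 0 < ε := by positivity
    -- testing at the identity bounds the total mass of the approximating functionals
    obtain ⟨m, τ, η, hτ, happ⟩ := hσ ξ {star x * x, 1} ε hεpos
    have h1 := happ (star x * x) (by simp)
    have h2 := happ 1 (by simp)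
    simp only [coeff_star_mul_self, coeff_one] at h1 h2
    rw [← Complex.ofReal_sum, ← Complex.ofReal_sub, Complex.norm_real, Real.norm_eq_abs,
      abs_lt] at h1 h2
    have h3 : ∑ l, ‖(τ l).hom x (η l)‖ ^ 2 ≤ C ^ 2 * ∑ l, ‖η l‖ ^ 2 := by
      rw [Finset.mul_sum]
      refine Finset.sum_le_sum fun l _ => ?_
      rw [← mul_pow]
      gcongr
      exact ((τ l).hom x).le_of_opNorm_le (h _ (hτ l)) _
    have h4 : C ^ 2 * ∑ l, ‖η l‖ ^ 2 ≤ C ^ 2 * (‖ξ‖ ^ 2 + ε) := by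
      gcongr
      linarith [h2.1]
    have h5 : ε * (C ^ 2 + 1) = δ := by rw [hε]; field_simp
    linarith [h1.2]
  rw [← mul_pow] at hsq
  exact (sq_le_sq₀ (norm_nonneg _) (by positivity)).1 hsq

end CStarRep

/-! ### Density in the unitary dual -/

lemma IrreducibleRep.isOpen_fellNhd {G : Type u} [Group G] (π : IrreducibleRep G) {n : ℕ}
    (ξ : Fin n → π.1.H) (Q : Finset G) {ε : ℝ} (hε : 0 < ε) : IsOpen (fellNhd π ξ Q ε) :=
  TopologicalSpace.isOpen_generateFrom_of_mem ⟨π, n, ξ, Q, ε, hε, rfl⟩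

lemma IrreducibleRep.mem_fellNhd_of_equivalent {G : Type u} [Group G] {π ρ ρ' : IrreducibleRep G}
    {n : ℕ} {ξ : Fin n → π.1.H} {Q : Finset G} {ε : ℝ} (h : UnitaryRep.Equivalent ρ.1 ρ'.1)
    (hρ : ρ ∈ fellNhd π ξ Q ε) : ρ' ∈ fellNhd π ξ Q ε := by
  obtain ⟨U, hU⟩ := h
  intro k
  obtain ⟨m, η, hη⟩ := hρ k
  refine ⟨m, fun l => U (η l), fun g hg => ?_⟩
  have hc : ∀ l, ρ'.1.coeff (U (η l)) g = ρ.1.coeff (η l) g := fun l => by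
    rw [UnitaryRep.coeff, ← hU, LinearIsometryEquiv.inner_map_map]; rfl
  simpa only [hc] using hη g hg

/-- A representation on a nonzero space that factors through one of the quotients `G / N κ`. -/
def UnitaryRep.FactorsThrough {G : Type u} [Group G] {ι : Type v} (N : ι → Subgroup G)
    (π : UnitaryRep G) : Prop :=
  Nontrivial π.H ∧ ∃ κ, N κ ≤ π.hom.ker

/-- Density in the unitary dual, in terms of functions of positive type. -/
theorem IsFDFamily.coeff_mem_coeffCone {G : Type u} [Group G] {ι : Type v} {N : ι → Subgroup G}
    (h : IsFDFamily N) (π : UnitaryRep G) (hπ : π.IsIrreducible) (ξ : π.H) :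
    π.coeff ξ ∈ coeffCone (UnitaryRep.FactorsThrough N) := by
  have hdense : Dense {c : UnitaryDual G | ∃ (κ : ι) (π : IrreducibleRep G),
      Quotient.mk _ π = c ∧ N κ ≤ π.1.hom.ker} := h
  have happrox : ∀ (Q : Finset G) (ε : ℝ), 0 < ε →
      ∃ ψ ∈ coeffCone (UnitaryRep.FactorsThrough N), ∀ g ∈ Q, ‖π.coeff ξ g - ψ g‖ < ε := by
    intro Q ε hε
    let W := IrreducibleRep.fellNhd ⟨π, hπ⟩ (fun _ : Fin 1 => ξ) Q ε
    -- neighbourhoods are saturated for unitary equivalence, so they are open in the quotient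
    have hopen : IsOpen ((Quotient.mk _ : IrreducibleRep G → UnitaryDual G) '' W) := by
      refine isOpen_coinduced.2 ?_
      convert! IrreducibleRep.isOpen_fellNhd ⟨π, hπ⟩ (fun _ : Fin 1 => ξ) Q hε
      refine Set.Subset.antisymm ?_ fun ρ hρ => ⟨ρ, hρ, rfl⟩
      rintro ρ ⟨ρ', hρ', he⟩
      exact IrreducibleRep.mem_fellNhd_of_equivalent (Quotient.exact he) hρ'
    have hmem : (⟨π, hπ⟩ : IrreducibleRep G) ∈ W := fun _ =>
      ⟨1, fun _ => ξ, fun g _ => by simpa using hε⟩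
    obtain ⟨_, ⟨ρ', hρ', rfl⟩, κ, ρ, he, hker⟩ :=
      hdense.inter_open_nonempty _ hopen ⟨_, _, hmem, rfl⟩
    obtain ⟨m, η, hη⟩ :=
      IrreducibleRep.mem_fellNhd_of_equivalent (Setoid.symm (Quotient.exact he)) hρ' 0
    refine ⟨∑ l, ρ.1.coeff (η l),
      sum_mem fun l _ => _root_.coeff_mem_coeffCone ⟨ρ.2.1, κ, hker⟩ (η l), fun g hg => ?_⟩
    simpa only [Finset.sum_apply] using hη g hg
  have hpos : ∀ n : ℕ, (0 : ℝ) < 1 / ((n : ℝ) + 1) := fun n => by positivity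
  choose! ψ hψ hψQ using happrox
  classical
  refine (AddSubmonoid.isClosed_topologicalClosure _).mem_of_tendsto (b := atTop)
    (f := fun k : Finset G × ℕ => ψ k.1 (1 / ((k.2 : ℝ) + 1))) (tendsto_pi_nhds.2 fun g => ?_)
    (Eventually.of_forall fun k => hψ _ _ (hpos _))
  rw [tendsto_iff_norm_sub_tendsto_zero]
  have hlim : Tendsto (fun k : Finset G × ℕ => 1 / ((k.2 : ℝ) + 1)) atTop (𝓝 0) := by
    rw [← prod_atTop_atTop_eq]
    exact tendsto_one_div_add_atTop_nhds_zero_nat.comp tendsto_snd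
  refine squeeze_zero' (Eventually.of_forall fun _ => norm_nonneg _) ?_ hlim
  filter_upwards [eventually_ge_atTop (({g} : Finset G), 0)] with k hk
  rw [norm_sub_rev]
  exact (hψQ _ _ (hpos _) g (hk.1 (Finset.mem_singleton_self g))).le

/-- For an FD family, all functions of positive type are limits of sums of coefficients of
representations that factor through the quotients. -/
theorem IsFDFamily.mem_coeffCone {G : Type u} [Group G] {ι : Type v} {N : ι → Subgroup G}
    (h : IsFDFamily N) {φ : G → ℂ} (hφ : IsPositiveType φ) :
    φ ∈ coeffCone (UnitaryRep.FactorsThrough N) :=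
  IsPositiveType.mem_coeffCone h.coeff_mem_coeffCone hφ

namespace FDFamily

variable {Γ : Type u} [Group Γ] (N : ℕ → Subgroup Γ) [∀ i, (N i).Normal] [∀ i, (N i).FiniteIndex]

/-- A finite sum of matrix coefficients of representations that factor through the quotients is the
family of coefficients of a finite sum of positive functionals at the finite levels. -/
lemma exists_functional_of_mem_matrixSums (hN : Antitone N) (i : ℕ) {F : Γ ⧸ N i → Γ ⧸ N i → Γ → ℂ}
    (hF : F ∈ matrixSums (Γ ⧸ N i) (UnitaryRep.FactorsThrough N)) :
    ∃ ψ ∈ CStarRep.functionalSums (finiteLevelReps N hN i), ∀ (f : Alg N i) (g : Γ),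
      ψ (CrossedProduct.ofAlg _ f * CrossedProduct.ofGrp _ g) = ∑ x, f x * F x (g⁻¹ • x) g := by
  induction hF using AddSubmonoid.closure_induction with
  | mem F h =>
    obtain ⟨π, η, ⟨hnt, κ, hκ⟩, rfl⟩ := h
    obtain ⟨τ, hτ, v, hv⟩ := exists_finiteLevelRep N hN (le_max_left i κ) π
      ((hN (le_max_right i κ)).trans hκ) η
    exact ⟨τ.coeff v, AddSubmonoid.subset_closure ⟨τ, hτ, v, rfl⟩, hv⟩
  | zero => exact ⟨0, zero_mem _, fun f g => by simp⟩
  | add F F' _ _ h h' =>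
    obtain ⟨ψ, hψ, e⟩ := h
    obtain ⟨ψ', hψ', e'⟩ := h'
    refine ⟨ψ + ψ', add_mem hψ hψ', fun f g => ?_⟩
    simp only [Pi.add_apply, e, e', mul_add, Finset.sum_add_distrib]

variable {N}

/-- Every representation of the crossed product is weakly contained in the representations that
factor through the finite levels. -/
theorem weaklyContained_finiteLevelReps (hN : Antitone N) (hFD : IsFDFamily N) (i : ℕ)
    (σ : CStarRep.{u + 1, w} (FullLevel N i)) : σ.WeaklyContained (finiteLevelReps N hN i) := by
  refine σ.weaklyContained_of_mem_closure fun ξ => ?_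
  obtain ⟨U, η, hσ⟩ := CrossedProduct.coeff_ofAlg_mul_ofGrp σ ξ
  have hmem : matrixCoeff U η ∈
      closure (matrixSums (Γ ⧸ N i) (UnitaryRep.FactorsThrough N) :
        Set (Γ ⧸ N i → Γ ⧸ N i → Γ → ℂ)) :=
    matrixCoeff_mem (fun φ hφ => hFD.mem_coeffCone hφ) U η
  have hne := mem_closure_iff_comap_neBot.1 hmem
  choose ψ hψ hψe using fun F : matrixSums (Γ ⧸ N i) (UnitaryRep.FactorsThrough N) =>
    exists_functional_of_mem_matrixSums N hN i F.2
  have hlim : ∀ (f : Alg N i) (g : Γ), Tendsto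
      (fun F => ψ F (CrossedProduct.ofAlg _ f * CrossedProduct.ofGrp _ g))
      (comap Subtype.val (𝓝 (matrixCoeff U η)))
      (𝓝 (σ.coeff ξ (CrossedProduct.ofAlg _ f * CrossedProduct.ofGrp _ g))) := by
    intro f g
    have hc : Continuous fun F : Γ ⧸ N i → Γ ⧸ N i → Γ → ℂ => ∑ x, f x * F x (g⁻¹ • x) g := by
      fun_prop
    simp only [hψe, hσ]
    exact (hc.tendsto _).comp tendsto_comap
  have hone : (1 : FullLevel N i) = CrossedProduct.ofAlg _ 1 * CrossedProduct.ofGrp _ 1 := by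
    have h1 := map_one (CrossedProduct.algHom (translation Γ (Γ ⧸ N i)))
    have h2 := congrArg Subtype.val (map_one (CrossedProduct.grpHom (translation Γ (Γ ⧸ N i))))
    exact ((congrArg₂ (· * ·) h1 h2).trans (one_mul 1)).symm
  refine mem_closure_of_tendsto (tendsto_pi_nhds.2 fun a => ?_) 
    (Eventually.of_forall hψ : ∀ᶠ F in comap Subtype.val (𝓝 (matrixCoeff U η)), _)
  refine CStarRep.tendsto_of_total σ ξ hψ (hone ▸ hlim 1 1)
    {a | ∃ f g, a = CrossedProduct.ofAlg _ f * CrossedProduct.ofGrp _ g} ?_ ?_ a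
  · exact fun M hM hT => CrossedProduct.eq_top_of_isClosed M hM fun f g => hT ⟨f, g, rfl⟩
  · rintro _ ⟨f, g, rfl⟩
    exact hlim f g

/-- The representations of the finite levels detect the norm of the crossed product. -/
lemma norm_le_of_finiteLevelReps (hN : Antitone N) (hFD : IsFDFamily N) (i : ℕ) (x : FullLevel N i)
    {C : ℝ} (hC : 0 ≤ C) (h : ∀ j (hij : i ≤ j), ‖natMap N hN hij x‖ ≤ C) : ‖x‖ ≤ C := by
  change ‖x.1‖ ≤ C
  refine lp.norm_le_of_forall_le hC fun r => ?_
  refine (weaklyContained_finiteLevelReps hN hFD i r.toCStarRep).norm_hom_le hC ?_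
  rintro _ ⟨j, hij, τ, rfl⟩
  exact (NonUnitalStarAlgHom.norm_apply_le τ.hom _).trans (h j hij)

end FDFamily

end

theorem mainTheorem3 {Γ : Type u} [Group Γ] [Countable Γ] (N : ℕ → Subgroup Γ)
    [∀ i, (N i).Normal] [∀ i, (N i).FiniteIndex] (hN : Antitone N) (hFD : IsFDFamily N) (i : ℕ) :
    Isometry (productHom (fun j : {j : ℕ // i ≤ j} => FDFamily.natMap N hN j.2)) ∧
    ∀ σ : CStarRep.{u + 1, w} (FDFamily.FullLevel N i),
      σ.WeaklyContained {τ : CStarRep.{u + 1, u} (FDFamily.FullLevel N i) |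
        ∃ (j : ℕ) (hij : i ≤ j) (τ' : CStarRep.{u + 1, u} (FDFamily.FiniteLevel N j)),
          τ = τ'.comp (FDFamily.natMap N hN hij)} := by
  refine ⟨AddMonoidHomClass.isometry_of_norm _ fun x => le_antisymm ?_ ?_,
    FDFamily.weaklyContained_finiteLevelReps hN hFD i⟩
  · exact NonUnitalStarAlgHom.norm_apply_le _ x
  · refine FDFamily.norm_le_of_finiteLevelReps hN hFD i x (norm_nonneg _) fun j hij => ?_
    exact lp.norm_apply_le_norm ENNReal.top_ne_zero
      (productHom (fun j : {j : ℕ // i ≤ j} => FDFamily.natMap N hN j.2) x) ⟨j, hij⟩
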